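/- Let $d\ge 2$. Let $\mathcal A=\bigotimes_{\mathbb Z}M_d(\mathbb C)$ be the C*-algebra of the two-sided quantum spin chain, i.e. the C*-inductive limit of $\mathcal A_\Lambda=\bigotimes_{z\in\Lambda}M_d(\mathbb C)$, $\Lambda\subset\mathbb Z$ finite; let $\mathcal A_R,\mathcal A_L\subset\mathcal A$ be the subalgebras of the half-chains $[0,\infty)$ and $(-\infty,-1]$. Write $Q^{(j)}$ for $Q\in M_d(\mathbb C)$ at the site $j$, let $\gamma$ be the *-automorphism of $\mathcal A$ with $\gamma(Q^{(j)})=Q^{(-j-1)}$ for all $Q,j$, and let $\gamma_{L\to R}:\mathcal A_L\to\mathcal A_R$ be its restriction. For a Hilbert space $\mathcal K$, $B(\mathcal K)$ denotes the bounded operators on it. Let $\omega$ be a pure state on $\mathcal A$ with $\omega\circ\gamma=\omega$ that has the split property: if $\pi_R$ is the GNS representation of $\omega|_{\mathcal A_R}$, then $\pi_R(\mathcal A_R)''$ is a type I factor. A reflection-split representation of $\omega$ is a quadruple $(\mathcal H,\pi,\Omega,\Gamma)$ in which $\pi$ is an irreducible representation of $\mathcal A_R$ on the Hilbert space $\mathcal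 H$, $\Omega\in\mathcal H\otimes\mathcal H$ is a unit vector such that $(\mathcal H\otimes\mathcal H,\hat\pi,\Omega)$ with $\hat\pi=(\pi\circ\gamma_{L\to R})\otimes\pi$ is a GNS triple of $\omega$, and $\Gamma$ is the unitary on $\mathcal H\otimes\mathcal H$ with $\Gamma\hat\pi(A)\Omega=\hat\pi(\gamma(A))\Omega$ for all $A\in\mathcal A$. The reflection index $\sigma_\omega$ is the sign such that $\Gamma(\xi\otimes\eta)=\sigma_\omega\,\eta\otimes\xi$ for all $\xi,\eta\in\mathcal H$ in every reflection-split representation of $\omega$. Let $(\mathcal H_\omega,\pi_\omega,\Omega_\omega,\Gamma_\omega)$ be a reflection-split representation of $\omega$, and let $s_\omega\in B(\mathcal H_\omega)$ be the projection for which $1\otimes s_\omega$ is the support projection of $\Omega_\omega$ in $1\otimes B(\mathcal H_\omega)$, i.e. the smallest projection in this algebra that fixes $\Omega_\omega$. Let $\mathcal M=s_\omega\otimes B(s_\omega\mathcal H_\omega)$, acting on $s_\omega\mathcal H_\omega\otimes s_\omega\mathcal H_\omega=(s_\omega\otimes s_\omega)(\mathcal H_\omega\otimes\mathcal H_\omega)$,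 and let $J_\omega$ be the modular conjugation of $(\mathcal M,\Omega_\omega)$: the anti-unitary $J_\omega$ in the polar decomposition $S=J_\omega\Delta_\omega^{1/2}$ of the closure $S$ of $x\Omega_\omega\mapsto x^*\Omega_\omega$, $x\in\mathcal M$. Then: 1. $\sigma_\omega$ is well defined: $\sigma_\omega\in\{1,-1\}$ and $\Gamma_\omega(\xi\otimes\eta)=\sigma_\omega\,\eta\otimes\xi$ for all $\xi,\eta\in\mathcal H_\omega$. 2. There is an anti-unitary $\theta$ on $s_\omega\mathcal H_\omega$ such that $$J_\omega(s_\omega\otimes x)J_\omega^*=\theta x\theta^*\otimes s_\omega\qquad\text{for all }x\in B(s_\omega\mathcal H_\omega),\tag{$*$}$$ and there is a sign $\kappa_\omega\in\{1,-1\}$ such that $\theta^2=\kappa_\omega s_\omega$ for every anti-unitary $\theta$ with $(*)$; and $$\kappa_\omega=\sigma_\omega.$$ 3. The index can be read off from a Schmidt decomposition: if $\Omega_\omega=\sum_k\sqrt{\lambda_k}\,\xi_k\otimes\zeta_k$ with all $\lambda_k>0$ and orthonormal families $(\xi_k)$, $(\zeta_k)$ in $\mathcal H_\omega$, then both families are orthonormal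 bases of $s_\omega\mathcal H_\omega$, and the unitary $u$ and the anti-unitary $c$ on $s_\omega\mathcal H_\omega$ with $u\zeta_k=\xi_k$ and $c\zeta_k=\zeta_k$ for all $k$ satisfy $u=\sigma_\omega\,c^*u^*c$. -/

import Mathlib

open scoped InnerProductSpace ComplexOrder TensorProduct lp
open UniformSpace

universe u v

noncomputable section

/-! ### The quasi-local algebra of a quantum spin chain

The configuration space `ℓ²(ℤ → Fin d)` carries a faithful action of all single-site matrix
algebras; on the coordinates in a finite set `Λ` the algebra `⨂_{z ∈ Λ} M_d` acts as it does on
`⨂_{z ∈ Λ} ℂ^d`.  As `⨂_{z ∈ Λ} M_d` has a unique C*-norm, the norm closure of the *-algebra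
generated by the sites in `X` is the C*-inductive limit of the algebras `⨂_{z ∈ Λ} M_d`,
`Λ ⊆ X` finite. -/

namespace SpinChain

/-- Configurations: an index of the standard basis of `ℂ^d` at every site of `ℤ`. -/
abbrev Config (d : ℕ) : Type := ℤ → Fin d

/-- The Hilbert space `ℓ²(ℤ → Fin d)`. -/
abbrev ConfigSpace (d : ℕ) : Type := ℓ²(Config d, ℂ)

/-- The involution `(s, μ) ↦ (s with s j replaced by μ, s j)`. -/
def swapAt {d : ℕ} (j : ℤ) : Config d × Fin d ≃ Config d × Fin d where
  toFun p := (Function.update p.1 j p.2, p.1 j)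
  invFun p := (Function.update p.1 j p.2, p.1 j)
  left_inv p := by simp
  right_inv p := by simp

/-- The coordinate formula for the matrix `Q` acting at the site `j`. -/
def siteFun {d : ℕ} (j : ℤ) (Q : Matrix (Fin d) (Fin d) ℂ) (f : Config d → ℂ) : Config d → ℂ :=
  fun s => ∑ μ, Q (s j) μ * f (Function.update s j μ)

theorem summable_sq {d : ℕ} (f : ConfigSpace d) : Summable fun s => ‖f s‖ ^ 2 := by
  have h := (lp.memℓp f).summable (by norm_num)
  simpa using h

theorem norm_sq_eq {d : ℕ} (f : ConfigSpace d) : ‖f‖ ^ 2 = ∑' s, ‖f s‖ ^ 2 := by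
  have h := lp.norm_rpow_eq_tsum (p := 2) (by norm_num) f
  simpa using h

theorem memlp_of_summable_sq {d : ℕ} {f : Config d → ℂ} (h : Summable fun s => ‖f s‖ ^ 2) :
    Memℓp f 2 := memℓp_gen (by simpa using h)

theorem hasSum_fst {d : ℕ} {h : Config d → ℝ} (hh : Summable h) :
    HasSum (fun p : Config d × Fin d => h p.1) (∑' s, (d : ℝ) * h s) := by
  have h1 : Summable fun p : Config d × Fin d => h p.1 := by
    have := Summable.mul_of_nonneg (f := fun s => |h s|) (g := fun _ : Fin d => (1 : ℝ)) hh.abs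
      (Summable.of_finite) (fun _ => abs_nonneg _) (fun _ => zero_le_one)
    exact Summable.of_norm_bounded this (fun p => by simp)
  have h2 := h1.tsum_prod
  simp only [tsum_fintype, Finset.sum_const, Finset.card_univ, Fintype.card_fin,
    nsmul_eq_mul] at h2
  exact h2 ▸ h1.hasSum

theorem hasSum_swap {d : ℕ} (j : ℤ) {h : Config d → ℝ} (hh : Summable h) :
    HasSum (fun p : Config d × Fin d => h (Function.update p.1 j p.2))
      (∑' s, (d : ℝ) * h s) := by
  have h1 := (Equiv.hasSum_iff (swapAt j)).mpr (hasSum_fst hh)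
  have h2 : (fun p : Config d × Fin d => h (Function.update p.1 j p.2)) =
      (fun p : Config d × Fin d => h p.1) ∘ swapAt j := rfl
  rw [h2]
  exact h1

theorem hasSum_update {d : ℕ} (j : ℤ) {h : Config d → ℝ} (hh : Summable h) :
    HasSum (fun s => ∑ μ, h (Function.update s j μ)) (∑' s, (d : ℝ) * h s) :=
  (hasSum_swap j hh).prod_fiberwise fun s =>
    hasSum_fintype fun μ => h (Function.update s j μ)

theorem siteFun_sq_le {d : ℕ} (j : ℤ) (Q : Matrix (Fin d) (Fin d) ℂ) (f : Config d → ℂ)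
    (s : Config d) : ‖siteFun j Q f s‖ ^ 2 ≤
      (∑ ν, ∑ μ, ‖Q ν μ‖ ^ 2) * ∑ μ, ‖f (Function.update s j μ)‖ ^ 2 := by
  calc ‖siteFun j Q f s‖ ^ 2
      ≤ (∑ μ, ‖Q (s j) μ‖ * ‖f (Function.update s j μ)‖) ^ 2 := by
        gcongr
        exact (norm_sum_le _ _).trans (le_of_eq (by simp))
    _ ≤ (∑ μ, ‖Q (s j) μ‖ ^ 2) * ∑ μ, ‖f (Function.update s j μ)‖ ^ 2 :=
        Finset.sum_mul_sq_le_sq_mul_sq _ _ _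
    _ ≤ _ := by
        refine mul_le_mul_of_nonneg_right ?_ (by positivity)
        exact Finset.single_le_sum (f := fun ν => ∑ μ, ‖Q ν μ‖ ^ 2)
          (fun ν _ => by positivity) (Finset.mem_univ (s j))

theorem siteFun_memlp {d : ℕ} (j : ℤ) (Q : Matrix (Fin d) (Fin d) ℂ) (f : ConfigSpace d) :
    Memℓp (siteFun j Q f) 2 :=
  memlp_of_summable_sq <| Summable.of_nonneg_of_le (fun _ => by positivity)
    (siteFun_sq_le j Q f) ((hasSum_update j (summable_sq f)).summable.mul_left _)

/-- The bounded operator `Q^{(j)}`: the matrix `Q` acting at the site `j`. -/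
def siteOp {d : ℕ} (j : ℤ) (Q : Matrix (Fin d) (Fin d) ℂ) : ConfigSpace d →L[ℂ] ConfigSpace d :=
  LinearMap.mkContinuous
    { toFun := fun f => ⟨siteFun j Q f, siteFun_memlp j Q f⟩
      map_add' := fun f g => by
        ext s
        change ∑ μ, Q (s j) μ * (f _ + g _) = ∑ μ, Q (s j) μ * f _ + ∑ μ, Q (s j) μ * g _
        simp [mul_add, Finset.sum_add_distrib]
      map_smul' := fun c f => by
        ext s
        simp [siteFun, Finset.mul_sum, mul_left_comm] }
    (Real.sqrt ((∑ ν, ∑ μ, ‖Q ν μ‖ ^ 2) * d))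
    (fun f => by
      refine le_of_sq_le_sq ?_ (by positivity)
      rw [norm_sq_eq, mul_pow, Real.sq_sqrt (by positivity), norm_sq_eq]
      have h := hasSum_update j (summable_sq f)
      refine (Summable.tsum_le_tsum (siteFun_sq_le j Q f)
        (summable_sq ⟨siteFun j Q f, siteFun_memlp j Q f⟩) (h.summable.mul_left _)).trans ?_
      rw [tsum_mul_left, h.tsum_eq, tsum_mul_left, mul_assoc])

theorem siteOp_apply {d : ℕ} (j : ℤ) (Q : Matrix (Fin d) (Fin d) ℂ) (f : ConfigSpace d)
    (s : Config d) : siteOp j Q f s = ∑ μ, Q (s j) μ * f (Function.update s j μ) := rfl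

theorem siteOp_inner {d : ℕ} (j : ℤ) (Q : Matrix (Fin d) (Fin d) ℂ) (f g : ConfigSpace d) :
    ⟪siteOp j Q.conjTranspose f, g⟫_ℂ = ⟪f, siteOp j Q g⟫_ℂ := by
  let G : Config d × Fin d → ℂ := fun p =>
    starRingEnd ℂ (f p.1) * (Q (p.1 j) p.2 * g (Function.update p.1 j p.2))
  have hg := hasSum_swap j (summable_sq g)
  have hG : Summable G := by
    refine Summable.of_norm_bounded (((hasSum_fst (summable_sq f)).summable.add hg.summable).mul_left
      (∑ ν, ∑ μ, ‖Q ν μ‖)) fun p => ?_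
    have hQ : ‖Q (p.1 j) p.2‖ ≤ ∑ ν, ∑ μ, ‖Q ν μ‖ :=
      (Finset.single_le_sum (f := fun μ => ‖Q (p.1 j) μ‖) (fun _ _ => norm_nonneg _)
        (Finset.mem_univ p.2)).trans
      (Finset.single_le_sum (f := fun ν => ∑ μ, ‖Q ν μ‖) (fun ν _ => by positivity)
        (Finset.mem_univ (p.1 j)))
    simp only [G, norm_mul, RCLike.norm_conj]
    calc _ = ‖Q (p.1 j) p.2‖ * (‖f p.1‖ * ‖g (Function.update p.1 j p.2)‖) := by ring
      _ ≤ _ := by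
        refine mul_le_mul hQ ?_ (by positivity) (by positivity)
        nlinarith [sq_nonneg (‖f p.1‖ - ‖g (Function.update p.1 j p.2)‖), norm_nonneg (f p.1),
          norm_nonneg (g (Function.update p.1 j p.2)), sq_nonneg ‖f p.1‖,
          sq_nonneg ‖g (Function.update p.1 j p.2)‖]
  have hG' : Summable fun p => G (swapAt j p) := (swapAt j).summable_iff.mpr hG
  have h1 : ⟪f, siteOp j Q g⟫_ℂ = ∑' p, G p := by
    rw [lp.inner_eq_tsum, hG.tsum_prod]
    refine tsum_congr fun s => ?_
    rw [tsum_fintype, siteOp_apply, RCLike.inner_apply, Finset.sum_mul]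
    exact Finset.sum_congr rfl fun μ _ => mul_comm _ _
  have h2 : ⟪siteOp j Q.conjTranspose f, g⟫_ℂ = ∑' p, G (swapAt j p) := by
    rw [lp.inner_eq_tsum, hG'.tsum_prod]
    refine tsum_congr fun s => ?_
    rw [tsum_fintype, siteOp_apply, RCLike.inner_apply, map_sum, Finset.mul_sum]
    refine Finset.sum_congr rfl fun μ _ => ?_
    simp only [G, swapAt, Equiv.coe_fn_mk, Function.update_self, Function.update_idem,
      Function.update_eq_self, map_mul, Matrix.conjTranspose_apply, RCLike.star_def,
      RCLike.conj_conj]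
    ring
  rw [h1, h2, (swapAt j).tsum_eq G]

/-- The copy of `M_d` at the site `j`, as a *-representation on `ℓ²(ℤ → Fin d)`. -/
def siteHom (d : ℕ) (j : ℤ) :
    Matrix (Fin d) (Fin d) ℂ →⋆ₐ[ℂ] (ConfigSpace d →L[ℂ] ConfigSpace d) where
  toFun := siteOp j
  map_one' := by
    ext f s
    simp [siteOp_apply, Matrix.one_apply]
  map_mul' P Q := by
    ext f s
    change siteOp j (P * Q) f s = siteOp j P (siteOp j Q f) s
    simp only [siteOp_apply, Matrix.mul_apply, Finset.sum_mul,
      Finset.mul_sum, Function.update_self, Function.update_idem, mul_assoc]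
    rw [Finset.sum_comm]
  map_zero' := by
    ext f s
    simp [siteOp_apply]
  map_add' P Q := by
    ext f s
    simp [siteOp_apply, add_mul, Finset.sum_add_distrib]
  commutes' c := by
    ext f s
    simp [siteOp_apply, Matrix.algebraMap_matrix_apply, ite_mul]
  map_star' Q := by
    rw [Matrix.star_eq_conjTranspose, ContinuousLinearMap.star_eq_adjoint]
    exact (ContinuousLinearMap.eq_adjoint_iff _ _).mpr fun f g => siteOp_inner j Q f g

theorem siteHom_commute {d : ℕ} {i j : ℤ} (hij : i ≠ j) (P Q : Matrix (Fin d) (Fin d) ℂ) :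
    Commute (siteHom d i P) (siteHom d j Q) := by
  ext f s
  change siteOp i P (siteOp j Q f) s = siteOp j Q (siteOp i P f) s
  simp only [siteOp_apply, Finset.mul_sum, Function.update_of_ne hij,
    Function.update_of_ne hij.symm]
  rw [Finset.sum_comm]
  refine Finset.sum_congr rfl fun μ _ => Finset.sum_congr rfl fun ν _ => ?_
  rw [Function.update_comm hij]
  ring

/-- The C*-algebra of the sites in `X ⊆ ℤ`: the norm closure of the *-algebra generated by the
matrices at the sites in `X`. -/
def chainAlgebra (d : ℕ) (X : Set ℤ) : StarSubalgebra ℂ (ConfigSpace d →L[ℂ] ConfigSpace d) :=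
  (StarAlgebra.adjoin ℂ {T | ∃ j ∈ X, ∃ Q, T = siteHom d j Q}).topologicalClosure

theorem chainAlgebra_mono {d : ℕ} {X Y : Set ℤ} (h : X ⊆ Y) :
    chainAlgebra d X ≤ chainAlgebra d Y :=
  StarSubalgebra.topologicalClosure_mono <| StarAlgebra.adjoin_mono <| by
    rintro T ⟨j, hj, Q, rfl⟩
    exact ⟨j, h hj, Q, rfl⟩

/-- The algebra `𝒜` of the two-sided chain. -/
abbrev Chain (d : ℕ) : StarSubalgebra ℂ (ConfigSpace d →L[ℂ] ConfigSpace d) :=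
  chainAlgebra d Set.univ

/-- The algebra `𝒜_R` of the half-chain `[0, ∞)`. -/
abbrev ChainR (d : ℕ) : StarSubalgebra ℂ (ConfigSpace d →L[ℂ] ConfigSpace d) :=
  chainAlgebra d (Set.Ici 0)

/-- The algebra `𝒜_L` of the half-chain `(-∞, -1]`. -/
abbrev ChainL (d : ℕ) : StarSubalgebra ℂ (ConfigSpace d →L[ℂ] ConfigSpace d) :=
  chainAlgebra d (Set.Iic (-1))

/-- The inclusion `𝒜_R → 𝒜`. -/
def inclR (d : ℕ) : ChainR d →⋆ₐ[ℂ] Chain d :=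
  StarAlgHom.codRestrict (ChainR d).subtype (Chain d)
    fun a => chainAlgebra_mono (Set.subset_univ _) a.2

/-- The inclusion `𝒜_L → 𝒜`. -/
def inclL (d : ℕ) : ChainL d →⋆ₐ[ℂ] Chain d :=
  StarAlgHom.codRestrict (ChainL d).subtype (Chain d)
    fun a => chainAlgebra_mono (Set.subset_univ _) a.2

theorem coe_inclR {d : ℕ} (a : ChainR d) :
    (inclR d a : ConfigSpace d →L[ℂ] ConfigSpace d) = a :=
  StarAlgHom.coe_codRestrict _ _ _ a

theorem coe_inclL {d : ℕ} (a : ChainL d) :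
    (inclL d a : ConfigSpace d →L[ℂ] ConfigSpace d) = a :=
  StarAlgHom.coe_codRestrict _ _ _ a

/-- The reflection `j ↦ -j-1` of the sites. -/
def refl (j : ℤ) : ℤ := -j - 1

theorem refl_refl (j : ℤ) : refl (refl j) = j := by
  simp [refl]

/-- The reflection of configurations. -/
def reflConfig (d : ℕ) : Config d ≃ Config d where
  toFun s := fun j => s (refl j)
  invFun s := fun j => s (refl j)
  left_inv s := by
    funext j
    simp [refl_refl]
  right_inv s := by
    funext j
    simp [refl_refl]

/-- The unitary on `ℓ²(ℤ → Fin d)` that reflects configurations. -/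
def reflUnitary (d : ℕ) : ConfigSpace d ≃ₗᵢ[ℂ] ConfigSpace d where
  toFun f := ⟨fun s => f (reflConfig d s),
    memlp_of_summable_sq 
      (((reflConfig d).summable_iff (f := fun s => ‖f s‖ ^ 2)).mpr (summable_sq f))⟩
  invFun f := ⟨fun s => f (reflConfig d s),
    memlp_of_summable_sq 
      (((reflConfig d).summable_iff (f := fun s => ‖f s‖ ^ 2)).mpr (summable_sq f))⟩
  left_inv f := by
    ext s
    exact congrArg f ((reflConfig d).left_inv s)
  right_inv f := by
    ext s
    exact congrArg f ((reflConfig d).left_inv s)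
  map_add' f g := by
    ext s
    rfl
  map_smul' c f := by
    ext s
    rfl
  norm_map' f := by
    refine (sq_eq_sq₀ (norm_nonneg _) (norm_nonneg _)).mp ?_
    rw [norm_sq_eq, norm_sq_eq]
    exact (reflConfig d).tsum_eq (fun s => ‖f s‖ ^ 2)

/-- Conjugation with the reflection unitary. -/
def reflConj (d : ℕ) :
    (ConfigSpace d →L[ℂ] ConfigSpace d) →⋆ₐ[ℂ] (ConfigSpace d →L[ℂ] ConfigSpace d) :=
  ((reflUnitary d).conjStarAlgEquiv :
    (ConfigSpace d →L[ℂ] ConfigSpace d) →⋆ₐ[ℂ] (ConfigSpace d →L[ℂ] ConfigSpace d))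

theorem reflConj_apply {d : ℕ} (T : ConfigSpace d →L[ℂ] ConfigSpace d) (f : ConfigSpace d) :
    reflConj d T f = reflUnitary d (T ((reflUnitary d).symm f)) := rfl

theorem reflConj_siteHom {d : ℕ} (j : ℤ) (Q : Matrix (Fin d) (Fin d) ℂ) :
    reflConj d (siteHom d j Q) = siteHom d (refl j) Q := by
  ext f s
  rw [reflConj_apply]
  change siteOp j Q ((reflUnitary d).symm f) (reflConfig d s) = siteOp (refl j) Q f s
  simp only [siteOp_apply]
  refine Finset.sum_congr rfl fun μ _ => ?_
  change Q (s (refl j)) μ * f (reflConfig d (Function.update (reflConfig d s) j μ)) = _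
  refine congrArg (fun t => Q (s (refl j)) μ * f t) (funext fun i => ?_)
  change Function.update (reflConfig d s) j μ (refl i) = _
  by_cases h : i = refl j
  · subst h
    simp [refl_refl]
  · have h' : refl i ≠ j := fun e => h (by rw [← e, refl_refl])
    rw [Function.update_of_ne h, Function.update_of_ne h']
    exact congrArg s (refl_refl i)

theorem reflConj_mem {d : ℕ} {X Y : Set ℤ} (h : ∀ j ∈ X, refl j ∈ Y)
    {T : ConfigSpace d →L[ℂ] ConfigSpace d} (hT : T ∈ chainAlgebra d X) :
    reflConj d T ∈ chainAlgebra d Y := by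
  have hc : Continuous (reflConj d) :=
    (reflUnitary d).toContinuousLinearEquiv.conjContinuousAlgEquiv.continuous
  have hle : chainAlgebra d X ≤ (chainAlgebra d Y).comap (reflConj d) := by
    refine StarSubalgebra.topologicalClosure_minimal (StarAlgebra.adjoin_le ?_) ?_
    · rintro _ ⟨j, hj, Q, rfl⟩
      change reflConj d (siteHom d j Q) ∈ chainAlgebra d Y
      rw [reflConj_siteHom]
      exact StarSubalgebra.le_topologicalClosure _
        (StarAlgebra.subset_adjoin ℂ _ ⟨refl j, h j hj, Q, rfl⟩)
    · exact (StarSubalgebra.isClosed_topologicalClosure _).preimage hc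
  exact hle hT

/-- The restriction of the reflection to a *-homomorphism between the algebras of the sites in `X`
and in `Y ⊇ -X-1`. -/
def reflHom (d : ℕ) (X Y : Set ℤ) (h : ∀ j ∈ X, refl j ∈ Y) :
    chainAlgebra d X →⋆ₐ[ℂ] chainAlgebra d Y :=
  StarAlgHom.codRestrict ((reflConj d).comp (chainAlgebra d X).subtype) (chainAlgebra d Y)
    fun T => reflConj_mem h T.2

theorem coe_reflHom {d : ℕ} {X Y : Set ℤ} (h : ∀ j ∈ X, refl j ∈ Y) (a : chainAlgebra d X) :
    (reflHom d X Y h a : ConfigSpace d →L[ℂ] ConfigSpace d) = reflConj d a :=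
  StarAlgHom.coe_codRestrict _ _ _ a

/-- The reflection `γ` of `𝒜`, with `γ (Q^{(j)}) = Q^{(-j-1)}`. -/
def reflection (d : ℕ) : Chain d →⋆ₐ[ℂ] Chain d :=
  reflHom d Set.univ Set.univ fun _ _ => Set.mem_univ _

/-- The restriction `γ_{L → R} : 𝒜_L → 𝒜_R` of the reflection. -/
def reflectionLR (d : ℕ) : ChainL d →⋆ₐ[ℂ] ChainR d :=
  reflHom d (Set.Iic (-1)) (Set.Ici 0) fun j hj => by
    simp only [Set.mem_Iic, Set.mem_Ici, refl] at *
    omega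

theorem reflection_inclL {d : ℕ} (a : ChainL d) :
    reflection d (inclL d a) = inclR d (reflectionLR d a) := by
  refine Subtype.ext ?_
  rw [coe_inclR, reflection, reflectionLR, coe_reflHom, coe_reflHom, coe_inclL]

theorem reflection_reflection {d : ℕ} (a : Chain d) : reflection d (reflection d a) = a := by
  refine Subtype.ext ?_
  rw [reflection, coe_reflHom, coe_reflHom]
  ext f s
  change (a : ConfigSpace d →L[ℂ] ConfigSpace d) (reflUnitary d (reflUnitary d f))
    (reflConfig d (reflConfig d s)) = _
  have h1 : reflUnitary d (reflUnitary d f) = f := (reflUnitary d).left_inv f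
  have h2 : reflConfig d (reflConfig d s) = s := (reflConfig d).left_inv s
  rw [h1, h2]

/-- The element `Q^{(j)}` of `𝒜`. -/
def site {d : ℕ} (j : ℤ) (Q : Matrix (Fin d) (Fin d) ℂ) : Chain d :=
  ⟨siteHom d j Q, StarSubalgebra.le_topologicalClosure _
    (StarAlgebra.subset_adjoin ℂ _ ⟨j, Set.mem_univ j, Q, rfl⟩)⟩

theorem reflection_site {d : ℕ} (j : ℤ) (Q : Matrix (Fin d) (Fin d) ℂ) :
    reflection d (site j Q) = site (-j - 1) Q :=
  Subtype.ext (reflConj_siteHom j Q)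

end SpinChain

/-! ### States, representations and von Neumann algebras -/

section Operator

/-- A state: a positive normalized linear functional. -/
def IsState {A : Type*} [Ring A] [StarRing A] [Algebra ℂ A] (φ : A →ₗ[ℂ] ℂ) : Prop :=
  φ 1 = 1 ∧ ∀ a, 0 ≤ φ (star a * a)

/-- A pure state: an extreme point of the set of states. -/
def IsPureState {A : Type*} [Ring A] [StarRing A] [Algebra ℂ A] (φ : A →ₗ[ℂ] ℂ) : Prop :=
  φ ∈ Set.extremePoints ℝ {ψ : A →ₗ[ℂ] ℂ | IsState ψ}

variable {H : Type*} [NormedAddCommGroup H] [InnerProductSpace ℂ H] [CompleteSpace H]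

/-- `(H, π, Ω)` is a GNS triple of `φ`: the vector `Ω` is cyclic for the representation `π` and
implements `φ`. -/
structure IsGNSTriple {A : Type*} [Ring A] [StarRing A] [Algebra ℂ A] (φ : A →ₗ[ℂ] ℂ)
    (π : A →⋆ₐ[ℂ] (H →L[ℂ] H)) (Ω : H) : Prop where
  inner_eq : ∀ a, ⟪Ω, π a Ω⟫_ℂ = φ a
  cyclic : Dense (Set.range fun a => π a Ω)

/-- A representation on a nonzero Hilbert space is irreducible if `0` and the whole space are the
only closed invariant subspaces. -/
structure IsIrreducibleRep {A : Type*} [Ring A] [StarRing A] [Algebra ℂ A]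
    (π : A →⋆ₐ[ℂ] (H →L[ℂ] H)) : Prop where
  nontrivial : Nontrivial H
  eq_bot_or_eq_top : ∀ V : Submodule ℂ H, IsClosed (V : Set H) →
    (∀ a, ∀ v ∈ V, π a v ∈ V) → V = ⊥ ∨ V = ⊤

/-- The von Neumann algebra `π(A)''` generated by a representation. -/
def generatedVN {A : Type*} [Ring A] [StarRing A] [Algebra ℂ A]
    (π : A →⋆ₐ[ℂ] (H →L[ℂ] H)) : VonNeumannAlgebra H where
  toStarSubalgebra := StarSubalgebra.centralizer ℂ
    (StarSubalgebra.centralizer ℂ (Set.range π) : Set (H →L[ℂ] H))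
  centralizer_centralizer' := by simp

/-- A type I factor: the center is trivial and there is a nonzero abelian projection. -/
structure IsTypeIFactor (M : VonNeumannAlgebra H) : Prop where
  nontrivial : Nontrivial H
  center : ∀ z ∈ M, z ∈ M.commutant → ∃ c : ℂ, z = c • (1 : H →L[ℂ] H)
  abelian : ∃ e ∈ M, IsStarProjection e ∧ e ≠ 0 ∧
    ∀ x ∈ M, ∀ y ∈ M, Commute (e * x * e) (e * y * e)

/-- `q` is the support projection of the vector `Ω` in the von Neumann algebra `M`: the smallest
projection of `M` that fixes `Ω`. -/
structure IsSupportProjection (M : Set (H →L[ℂ] H)) (Ω : H) (q : H →L[ℂ] H) : Prop where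
  mem : q ∈ M
  proj : IsStarProjection q
  apply_eq : q Ω = Ω
  le : ∀ r ∈ M, IsStarProjection r → r Ω = Ω → r * q = q

/-- The graph of the antilinear operator `S₀ : x Ω ↦ x* Ω`, `x ∈ M`. -/
def tomitaGraph (M : Set (H →L[ℂ] H)) (Ω : H) : Set (H × H) :=
  {p | ∃ x ∈ M, p = (x Ω, ContinuousLinearMap.adjoint x Ω)}

/-- `J` is the modular conjugation of `(M, Ω)`: the closure `S` of `x Ω ↦ x* Ω` has the polar
decomposition `S = J D`, with `J` anti-unitary and `D` (which is `Δ^{1/2}`) positive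
self-adjoint. -/
def IsModularConjugation (M : Set (H →L[ℂ] H)) (Ω : H) (J : H ≃ₗᵢ⋆[ℂ] H) : Prop :=
  ∃ D : H →ₗ.[ℂ] H, IsSelfAdjoint D ∧ (∀ v : D.domain, 0 ≤ ⟪(v : H), D v⟫_ℂ) ∧
    closure (tomitaGraph M Ω) = {p | ∃ v : D.domain, p = ((v : H), J (D v))}

end Operator

/-! ### Hilbert space tensor products -/

section Tensor

/-- The Hilbert space tensor product. -/
abbrev HilbertTensor (E F : Type*) [NormedAddCommGroup E] [InnerProductSpace ℂ E]
    [NormedAddCommGroup F] [InnerProductSpace ℂ F] : Type _ := Completion (E ⊗[ℂ] F)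

variable {E F E' F' : Type*} [NormedAddCommGroup E] [InnerProductSpace ℂ E]
  [NormedAddCommGroup F] [InnerProductSpace ℂ F]
  [NormedAddCommGroup E'] [InnerProductSpace ℂ E']
  [NormedAddCommGroup F'] [InnerProductSpace ℂ F']

/-- The vector `ξ ⊗ η`. -/
def tensorVec (ξ : E) (η : F) : HilbertTensor E F := ((ξ ⊗ₜ[ℂ] η : E ⊗[ℂ] F) : Completion _)

/-- The bounded operator `a ⊗ b`. -/
def tensorOp (a : E →L[ℂ] E') (b : F →L[ℂ] F') : HilbertTensor E F →L[ℂ] HilbertTensor E' F' :=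
  (TensorProduct.mapL a b).completion

theorem tensorOp_tensorVec (a : E →L[ℂ] E') (b : F →L[ℂ] F') (ξ : E) (η : F) :
    tensorOp a b (tensorVec ξ η) = tensorVec (a ξ) (b η) := by
  simp [tensorOp, tensorVec]

variable (E F) in
/-- The von Neumann algebra `1 ⊗ B(F)` on `E ⊗ F`. -/
def rightFactor : Set (HilbertTensor E F →L[ℂ] HilbertTensor E F) :=
  Set.range fun x : F →L[ℂ] F => tensorOp (ContinuousLinearMap.id ℂ E) x

end Tensor

/-! ### Reflection-split representations and the two signs -/

namespace SpinChain

/-- The split property: if `(H, π, Ω)` is the GNS triple of the restriction of `ω` to `𝒜_R`, then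
`π(𝒜_R)''` is a type I factor. -/
def HasSplitProperty {d : ℕ} (ω : Chain d →ₗ[ℂ] ℂ) : Prop :=
  ∃ (H : Type) (_ : NormedAddCommGroup H) (_ : InnerProductSpace ℂ H) (_ : CompleteSpace H)
    (π : ChainR d →⋆ₐ[ℂ] (H →L[ℂ] H)) (Ω : H),
    IsGNSTriple (ω ∘ₗ (inclR d).toLinearMap) π Ω ∧ IsTypeIFactor (generatedVN π)

variable {H : Type u} [NormedAddCommGroup H] [InnerProductSpace ℂ H] [CompleteSpace H]

/-- `ρ` is the representation `(π ∘ γ_{L → R}) ⊗ π` of `𝒜 = 𝒜_L ⊗ 𝒜_R` on `H ⊗ H`. -/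
def IsDoubledRep {d : ℕ} (π : ChainR d →⋆ₐ[ℂ] (H →L[ℂ] H))
    (ρ : Chain d →⋆ₐ[ℂ] (HilbertTensor H H →L[ℂ] HilbertTensor H H)) : Prop :=
  ∀ (a : ChainL d) (b : ChainR d),
    ρ (inclL d a * inclR d b) = tensorOp (π (reflectionLR d a)) (π b)

/-- `(H, π, Ω, Γ)` is a reflection-split representation associated to `ω`. -/
structure IsReflectionSplitRep {d : ℕ} (ω : Chain d →ₗ[ℂ] ℂ)
    (π : ChainR d →⋆ₐ[ℂ] (H →L[ℂ] H)) (Ω : HilbertTensor H H)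
    (Γ : HilbertTensor H H ≃ₗᵢ[ℂ] HilbertTensor H H) : Prop where
  irreducible : IsIrreducibleRep π
  norm_eq_one : ‖Ω‖ = 1
  exists_rep : ∃ ρ : Chain d →⋆ₐ[ℂ] (HilbertTensor H H →L[ℂ] HilbertTensor H H),
    IsDoubledRep π ρ ∧ IsGNSTriple ω ρ Ω ∧ ∀ a, Γ (ρ a Ω) = ρ (reflection d a) Ω

/-- `σ` is a sign with `Γ (ξ ⊗ η) = σ (η ⊗ ξ)` in every reflection-split representation of `ω`. -/
def IsReflectionIndex {d : ℕ} (ω : Chain d →ₗ[ℂ] ℂ) (σ : ℤ) : Prop :=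
  (σ = 1 ∨ σ = -1) ∧
    ∀ (H : Type u) [NormedAddCommGroup H] [InnerProductSpace ℂ H] [CompleteSpace H]
      (π : ChainR d →⋆ₐ[ℂ] (H →L[ℂ] H)) (Ω : HilbertTensor H H)
      (Γ : HilbertTensor H H ≃ₗᵢ[ℂ] HilbertTensor H H),
      IsReflectionSplitRep ω π Ω Γ → ∀ ξ η : H, Γ (tensorVec ξ η) = σ • tensorVec η ξ

/-- The reflection index `σ_ω`. -/
def reflectionIndex {d : ℕ} (ω : Chain d →ₗ[ℂ] ℂ) : ℤ :=
  Classical.epsilon (IsReflectionIndex.{u} ω)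

/-- The subspace `s H`. -/
abbrev corner (s : H →L[ℂ] H) : Submodule ℂ H := s.range

/-- The vector `(s ⊗ s) Ω`, as an element of `s H ⊗ s H`, the range of `s ⊗ s`. -/
def cornerVec (s : H →L[ℂ] H) (Ω : HilbertTensor H H) :
    HilbertTensor (corner s) (corner s) :=
  tensorOp s.rangeRestrict s.rangeRestrict Ω

/-- The operator `θ x θ*`, for an anti-unitary `θ`. -/
def antiConj {K : Type*} [NormedAddCommGroup K] [InnerProductSpace ℂ K] (θ : K ≃ₗᵢ⋆[ℂ] K)
    (x : K →L[ℂ] K) : K →L[ℂ] K :=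
  (θ : K →L⋆[ℂ] K).comp (x.comp (θ.symm : K →L⋆[ℂ] K))

/-- The anti-unitary `θ` satisfies `J (1 ⊗ x) J* = θ x θ* ⊗ 1` for all bounded `x`. -/
def Implements {K : Type*} [NormedAddCommGroup K] [InnerProductSpace ℂ K]
    (J : HilbertTensor K K ≃ₗᵢ⋆[ℂ] HilbertTensor K K) (θ : K ≃ₗᵢ⋆[ℂ] K) : Prop :=
  ∀ x : K →L[ℂ] K, antiConj J (tensorOp (ContinuousLinearMap.id ℂ K) x) =
    tensorOp (antiConj θ x) (ContinuousLinearMap.id ℂ K)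

end SpinChain

end

/-! A vector `Ω` of `H ⊗ H` is the same datum as a compact antilinear operator `T = antiOp Ω` with
`⟪ξ, T η⟫ = ⟪ξ ⊗ η, Ω⟫`, and all three assertions become statements about `T`.

The sign comes from Schur's lemma. `Γ` composed with the flip commutes with `π(a) ⊗ 1` and `1 ⊗
π(a)`, hence is a scalar, and `Γ² = 1` makes it `±1` (`IsReflectionSplitRep.exists_sign`). Two
reflection-split representations are connected by an intertwiner of the form `c • (K ⊗ K)`, which
respects the flips, so the sign `σ` depends on `ω` only (`IsReflectionSplitRep.sign_unique`). The
relation `Γ Ω = Ω` then says `⟪ξ, T η⟫ = σ ⟪η, T ξ⟫`, that is, `T* = σ T` for the antilinear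
adjoint.

Because of this symmetry the range of `T` lies in `s H`, and minimality of the support makes `T`
injective there. A singular value decomposition `T b_k = r_k b'_k` yields the anti-unitary `θ : b_k
↦ b'_k` of the polar decomposition of `T`, and `T* = σ T` forces `θ² = σ`
(`IsSignedAntiOp.antiunitary_sq`). The rank-one elements of `1 ⊗ B(s H)` send the vector to
eigenvectors of `Δ`, from which `J (θ f ⊗ e) = θ e ⊗ f` (`IsModularConjugation.apply_tensorVec`). So
`θ` implements `J`. Any other implementing anti-unitary is `c θ` with `|c| = 1`, and it has the same
square since `c θ c θ = |c|² θ²`.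

A Schmidt decomposition of `Ω` is precisely a singular value decomposition of `T`, with `θ = u c`;
the formula for `u` is `(u c)² = σ` rearranged with `c² = 1`. -/

noncomputable section

/-! ### Hilbert tensor products and the antilinear operator of a vector -/

section TensorBasics

variable {E F E' F' : Type*} [NormedAddCommGroup E] [InnerProductSpace ℂ E]
  [NormedAddCommGroup F] [InnerProductSpace ℂ F]
  [NormedAddCommGroup E'] [InnerProductSpace ℂ E']
  [NormedAddCommGroup F'] [InnerProductSpace ℂ F']

theorem inner_tensorVec (ξ ξ' : E) (η η' : F) :
    ⟪tensorVec ξ η, tensorVec ξ' η'⟫_ℂ = ⟪ξ, ξ'⟫_ℂ * ⟪η, η'⟫_ℂ := by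
  simp [tensorVec]

theorem norm_tensorVec (ξ : E) (η : F) : ‖tensorVec ξ η‖ = ‖ξ‖ * ‖η‖ := by
  simp [tensorVec]

/-- The bounded operator `η ↦ ξ ⊗ η`. -/
def tensorLeft (F : Type*) [NormedAddCommGroup F] [InnerProductSpace ℂ F] (ξ : E) :
    F →L[ℂ] HilbertTensor E F :=
  (Completion.toComplL : E ⊗[ℂ] F →L[ℂ] _).comp (TensorProduct.mkL ℂ E F ξ)

/-- The bounded operator `ξ ↦ ξ ⊗ η`. -/
def tensorRight (E : Type*) [NormedAddCommGroup E] [InnerProductSpace ℂ E] (η : F) :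
    E →L[ℂ] HilbertTensor E F :=
  (Completion.toComplL : E ⊗[ℂ] F →L[ℂ] _).comp ((TensorProduct.mkL ℂ E F).flip η)

@[simp] theorem tensorLeft_apply (ξ : E) (η : F) : tensorLeft F ξ η = tensorVec ξ η := rfl

@[simp] theorem tensorRight_apply (ξ : E) (η : F) : tensorRight E η ξ = tensorVec ξ η := rfl

theorem dense_span_tensorVec :
    Dense (Submodule.span ℂ (Set.range fun p : E × F => tensorVec p.1 p.2) :
      Set (HilbertTensor E F)) := by
  refine (Completion.denseRange_coe (α := E ⊗[ℂ] F)).mono ?_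
  rintro _ ⟨x, rfl⟩
  induction x with
  | zero =>
    rw [Completion.coe_zero]
    exact Submodule.zero_mem _
  | tmul ξ η => exact Submodule.subset_span ⟨(ξ, η), rfl⟩
  | add x y hx hy =>
    rw [Completion.coe_add]
    exact Submodule.add_mem _ hx hy

theorem clm_ext_tensorVec {σ : ℂ →+* ℂ} {G : Type*} [NormedAddCommGroup G] [NormedSpace ℂ G]
    {f g : HilbertTensor E F →SL[σ] G} (h : ∀ ξ η, f (tensorVec ξ η) = g (tensorVec ξ η)) :
    f = g := by
  refine ContinuousLinearMap.ext_on dense_span_tensorVec ?_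
  rintro _ ⟨⟨ξ, η⟩, rfl⟩
  exact h ξ η

theorem ext_inner_tensorVec {Φ Ψ : HilbertTensor E F}
    (h : ∀ ξ η, ⟪tensorVec ξ η, Φ⟫_ℂ = ⟪tensorVec ξ η, Ψ⟫_ℂ) : Φ = Ψ := by
  refine dense_span_tensorVec.eq_of_inner_right (𝕜 := ℂ) fun x hx => ?_
  induction hx using Submodule.span_induction with
  | mem x hx =>
    obtain ⟨⟨ξ, η⟩, rfl⟩ := hx
    exact h ξ η
  | zero => simp
  | add x y _ _ hx hy => rw [inner_add_left, inner_add_left, hx, hy]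
  | smul c x _ hx => rw [inner_smul_left, inner_smul_left, hx]

theorem adjoint_tensorOp [CompleteSpace E] [CompleteSpace F] [CompleteSpace E'] [CompleteSpace F']
    (a : E →L[ℂ] E') (b : F →L[ℂ] F') : ContinuousLinearMap.adjoint (tensorOp a b) =
      tensorOp (ContinuousLinearMap.adjoint a) (ContinuousLinearMap.adjoint b) := by
  refine clm_ext_tensorVec fun ξ η => ext_inner_tensorVec fun ξ' η' => ?_
  rw [ContinuousLinearMap.adjoint_inner_right, tensorOp_tensorVec, tensorOp_tensorVec,
    inner_tensorVec, inner_tensorVec, ContinuousLinearMap.adjoint_inner_right,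
    ContinuousLinearMap.adjoint_inner_right]

theorem inner_tensorVec_tensorOp [CompleteSpace E] [CompleteSpace F] [CompleteSpace E']
    [CompleteSpace F'] (a : E →L[ℂ] E') (b : F →L[ℂ] F') (ξ : E') (η : F')
    (Φ : HilbertTensor E F) : ⟪tensorVec ξ η, tensorOp a b Φ⟫_ℂ =
      ⟪tensorVec (ContinuousLinearMap.adjoint a ξ) (ContinuousLinearMap.adjoint b η), Φ⟫_ℂ := by
  rw [← tensorOp_tensorVec, ← adjoint_tensorOp, ContinuousLinearMap.adjoint_inner_left]

variable (E F) in
/-- The flip `ξ ⊗ η ↦ η ⊗ ξ`. -/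
def tensorFlip : HilbertTensor E F →L[ℂ] HilbertTensor F E :=
  ((TensorProduct.commIsometry ℂ E F).toContinuousLinearEquiv :
    E ⊗[ℂ] F →L[ℂ] F ⊗[ℂ] E).completion

@[simp] theorem tensorFlip_tensorVec (ξ : E) (η : F) :
    tensorFlip E F (tensorVec ξ η) = tensorVec η ξ := by
  simp [tensorFlip, tensorVec]

theorem adjoint_tensorFlip :
    ContinuousLinearMap.adjoint (tensorFlip E F) = tensorFlip F E := by
  refine clm_ext_tensorVec fun ξ η => ext_inner_tensorVec fun ξ' η' => ?_
  rw [ContinuousLinearMap.adjoint_inner_right, tensorFlip_tensorVec, tensorFlip_tensorVec,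
    inner_tensorVec, inner_tensorVec, mul_comm]

/-- The antilinear operator `T` with `⟪ξ, T η⟫ = ⟪ξ ⊗ η, Φ⟫` that corresponds to a vector
`Φ ∈ E ⊗ F`. -/
def antiOp [CompleteSpace E] (Φ : HilbertTensor E F) : F →L⋆[ℂ] E :=
  LinearMap.mkContinuous
    { toFun := fun η => ContinuousLinearMap.adjoint (tensorRight E η) Φ
      map_add' := fun η η' => ext_inner_left ℂ fun ξ => by
        simp only [inner_add_right, ContinuousLinearMap.adjoint_inner_right, tensorRight_apply]
        rw [← inner_add_left, ← tensorLeft_apply, map_add]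
        rfl
      map_smul' := fun c η => ext_inner_left ℂ fun ξ => by
        simp only [inner_smul_right, ContinuousLinearMap.adjoint_inner_right, tensorRight_apply]
        rw [← inner_smul_left, ← tensorLeft_apply, map_smul]
        rfl } ‖Φ‖ fun η => by
      refine ((ContinuousLinearMap.adjoint (tensorRight E η)).le_opNorm Φ).trans ?_
      rw [mul_comm, LinearIsometryEquiv.norm_map]
      refine mul_le_mul_of_nonneg_left ?_ (norm_nonneg _)
      refine ContinuousLinearMap.opNorm_le_bound _ (norm_nonneg _) fun ξ => ?_
      rw [tensorRight_apply, norm_tensorVec, mul_comm]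

theorem inner_antiOp [CompleteSpace E] (Φ : HilbertTensor E F) (ξ : E) (η : F) :
    ⟪ξ, antiOp Φ η⟫_ℂ = ⟪tensorVec ξ η, Φ⟫_ℂ :=
  ContinuousLinearMap.adjoint_inner_right (tensorRight E η) ξ Φ

theorem norm_antiOp_le [CompleteSpace E] (Φ : HilbertTensor E F) : ‖antiOp Φ‖ ≤ ‖Φ‖ :=
  LinearMap.mkContinuous_norm_le _ (norm_nonneg _) _

variable (E F) in
/-- The map that takes a vector in `E ⊗ F` to the corresponding antilinear operator. -/
def antiOpL [CompleteSpace E] : HilbertTensor E F →L[ℂ] (F →L⋆[ℂ] E) :=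
  LinearMap.mkContinuous
    { toFun := antiOp
      map_add' := fun Φ Ψ => by
        ext η
        exact map_add (ContinuousLinearMap.adjoint (tensorRight E η)) Φ Ψ
      map_smul' := fun c Φ => by
        ext η
        exact map_smul (ContinuousLinearMap.adjoint (tensorRight E η)) c Φ } 1 fun Φ => by simpa using norm_antiOp_le Φ

theorem antiOp_tensorVec [CompleteSpace E] (ξ : E) (η η' : F) :
    antiOp (tensorVec ξ η) η' = ⟪η', η⟫_ℂ • ξ := by
  refine ext_inner_left ℂ fun ξ' => ?_
  rw [inner_antiOp, inner_tensorVec, inner_smul_right, mul_comm]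

/-- Elementary tensors give operators of rank at most one, their span is dense, and compactness
survives limits in operator norm, which `antiOpL` controls by the norm of the vector. -/
theorem isCompactOperator_antiOp [CompleteSpace E] (Φ : HilbertTensor E F) :
    IsCompactOperator (antiOp Φ) := by
  have hcl : IsClosed {f : F →L⋆[ℂ] E | IsCompactOperator f} :=
    isClosed_setOfPred_isCompactOperator
  have hmem : Φ ∈ closure (Submodule.span ℂ (Set.range fun p : E × F => tensorVec p.1 p.2) :
      Set (HilbertTensor E F)) := dense_span_tensorVec Φ
  refine (hcl.preimage (antiOpL E F).continuous).closure_subset_iff.mpr ?_ hmem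
  intro x hx
  change IsCompactOperator (antiOpL E F x)
  induction hx using Submodule.span_induction with
  | mem x hx =>
    obtain ⟨⟨ξ, η⟩, rfl⟩ := hx
    have h := (isCompactOperator_of_locallyCompactSpace_rng
      (ContinuousLinearMap.toSpanSingleton ℂ ξ)).comp_clm (innerSLFlip ℂ η)
    have e : ⇑(antiOpL E F (tensorVec ξ η)) =
        ⇑(ContinuousLinearMap.toSpanSingleton ℂ ξ) ∘ ⇑(innerSLFlip ℂ η) :=
      funext fun η' => antiOp_tensorVec ξ η η'
    exact e ▸ h
  | zero =>
    rw [map_zero]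
    exact isCompactOperator_zero
  | add x y _ _ hx hy =>
    rw [map_add]
    exact hx.add hy
  | smul c x _ hx =>
    rw [map_smul]
    exact hx.smul c

end TensorBasics

/-! ### Schur's lemma and uniqueness of intertwiners -/

section Schur

variable {A : Type*} [Ring A] [StarRing A] [Algebra ℂ A]
  {H H' : Type*} [NormedAddCommGroup H] [InnerProductSpace ℂ H] [CompleteSpace H]
  [NormedAddCommGroup H'] [InnerProductSpace ℂ H'] [CompleteSpace H']
  {π : A →⋆ₐ[ℂ] (H →L[ℂ] H)} {π' : A →⋆ₐ[ℂ] (H' →L[ℂ] H')}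

theorem IsIrreducibleRep.eq_zero_or_eq_zero_of_mul_eq_zero (hπ : IsIrreducibleRep π)
    {S T : H →L[ℂ] H} (hS : ∀ a, Commute S (π a)) (hST : S * T = 0) : S = 0 ∨ T = 0 := by
  have hinv : ∀ a, ∀ v ∈ S.ker, π a v ∈ S.ker := fun a v hv => by
    change S v = 0 at hv
    change (S * π a) v = 0
    rw [(hS a).eq]
    change π a (S v) = 0
    rw [hv, map_zero]
  rcases hπ.eq_bot_or_eq_top S.ker S.isClosed_ker hinv with h | h
  · right
    ext v
    have : T v ∈ S.ker := by
      change (S * T) v = 0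
      rw [hST]
      rfl
    rw [h] at this
    simpa using this
  · left
    ext v
    have : v ∈ S.ker := h ▸ Submodule.mem_top
    exact this

/-- Two distinct spectral points would be separated by functions `f`, `g` with `f g = 0` that are
nonzero on the spectrum. The operators `f(T)` and `g(T)` commute with `π`, so the kernel of `f(T)`
is invariant, and irreducibility makes one of them vanish. Hence the spectrum is a single point. -/
theorem IsIrreducibleRep.exists_eq_smul_one_of_isSelfAdjoint (hπ : IsIrreducibleRep π)
    {T : H →L[ℂ] H} (hT : IsSelfAdjoint T) (hc : ∀ a, Commute T (π a)) :
    ∃ r : ℝ, T = (r : ℂ) • (1 : H →L[ℂ] H) := by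
  have := hπ.nontrivial
  obtain ⟨r, hr⟩ := ContinuousFunctionalCalculus.spectrum_nonempty (R := ℝ) T hT
  have key : ∀ x ∈ spectrum ℝ T, ∀ y ∈ spectrum ℝ T, ¬ x < y := fun x hx y hy hxy => by
    -- The positive and negative parts of `t - (x + y) / 2`: disjoint supports split at the
    -- midpoint, with `f y > 0` and `g x > 0`.
    let f : ℝ → ℝ := fun t => max 0 (t - (x + y) / 2)
    let g : ℝ → ℝ := fun t => max 0 ((x + y) / 2 - t)
    have hf : Continuous f := by fun_prop
    have hg : Continuous g := by fun_prop
    have hfg : cfc f T * cfc g T = 0 := by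
      rw [← cfc_mul f g T hf.continuousOn hg.continuousOn]
      have : (fun t => f t * g t) = fun _ => 0 := by
        funext t
        rcases le_total t ((x + y) / 2) with h | h
        · simp [f, max_eq_left (sub_nonpos.mpr h)]
        · simp [g, max_eq_left (sub_nonpos.mpr h)]
      rw [this, cfc_const_zero]
    have hzero : ∀ h : ℝ → ℝ, Continuous h → cfc h T = 0 → ∀ t ∈ spectrum ℝ T, h t = 0 :=
      fun h hh h0 t ht => by
        have : h t ∈ spectrum ℝ (cfc h T) := by
          rw [cfc_map_spectrum h T hT hh.continuousOn]
          exact ⟨t, ht, rfl⟩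
        rwa [h0, spectrum.zero_eq, Set.mem_singleton_iff] at this
    rcases hπ.eq_zero_or_eq_zero_of_mul_eq_zero (fun a => (hc a).cfc_real f) hfg with h | h
    · have h1 := (max_eq_left_iff.mp (hzero f hf h y hy))
      linarith
    · have h1 := (max_eq_left_iff.mp (hzero g hg h x hx))
      linarith
  refine ⟨r, (CFC.eq_algebraMap_of_spectrum_subset_singleton (R := ℝ) T r (fun x hx => ?_) hT).trans
    ?_⟩
  · exact le_antisymm (not_lt.mp (key r hr x hx)) (not_lt.mp (key x hx r hr))
  · rw [Algebra.algebraMap_eq_smul_one]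
    ext v
    simp

/-- Schur's lemma. -/
theorem IsIrreducibleRep.exists_eq_smul_one (hπ : IsIrreducibleRep π)
    {T : H →L[ℂ] H} (hc : ∀ a, Commute T (π a)) : ∃ c : ℂ, T = c • (1 : H →L[ℂ] H) := by
  have hc' : ∀ a, Commute (star T) (π a) := fun a => by
    have := (hc (star a)).star_star
    rwa [map_star, star_star] at this
  obtain ⟨r, hr⟩ := hπ.exists_eq_smul_one_of_isSelfAdjoint (T := T + star T)
    (IsSelfAdjoint.add_star_self T) fun a => (hc a).add_left (hc' a)
  obtain ⟨t, ht⟩ := hπ.exists_eq_smul_one_of_isSelfAdjoint (T := Complex.I • (T - star T))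
    (by
      rw [IsSelfAdjoint, star_smul, star_sub, star_star, RCLike.star_def, Complex.conj_I,
        ← neg_sub T, smul_neg, neg_smul, neg_neg])
    fun a => ((hc a).sub_left (hc' a)).smul_left _
  refine ⟨(1 / 2 : ℂ) * (r - Complex.I * t), ?_⟩
  have h1 : T = (1 / 2 : ℂ) • ((T + star T) - Complex.I • (Complex.I • (T - star T))) := by
    rw [smul_smul, Complex.I_mul_I]
    module
  rw [h1, hr, ht]
  module

/-- An operator that intertwines two representations. -/
def Intertwines (π : A →⋆ₐ[ℂ] (H →L[ℂ] H)) (π' : A →⋆ₐ[ℂ] (H' →L[ℂ] H'))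
    (K : H →L[ℂ] H') : Prop :=
  ∀ a, K ∘L π a = π' a ∘L K

theorem Intertwines.adjoint {K : H →L[ℂ] H'} (hK : Intertwines π π' K) :
    Intertwines π' π (ContinuousLinearMap.adjoint K) := fun a => by
  have h := congrArg ContinuousLinearMap.adjoint (hK (star a))
  rw [ContinuousLinearMap.adjoint_comp, ContinuousLinearMap.adjoint_comp,
    ← ContinuousLinearMap.star_eq_adjoint, ← ContinuousLinearMap.star_eq_adjoint, ← map_star,
    ← map_star, star_star] at h
  exact h.symm

theorem Intertwines.adjoint_comp {K L : H →L[ℂ] H'} (hK : Intertwines π π' K)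
    (hL : Intertwines π π' L) (a : A) :
    Commute (ContinuousLinearMap.adjoint K ∘L L) (π a) := by
  change (ContinuousLinearMap.adjoint K ∘L L) ∘L π a = π a ∘L (ContinuousLinearMap.adjoint K ∘L L)
  rw [ContinuousLinearMap.comp_assoc, hL a, ← ContinuousLinearMap.comp_assoc, hK.adjoint a,
    ContinuousLinearMap.comp_assoc]

/-- By Schur's lemma `K* L = a` and `K K* = b` are scalars, and evaluating `K K* L` in two ways
gives `b L = a K`. Here `b ≠ 0`, since `K K* = 0` would force `K = 0`. -/
theorem Intertwines.exists_eq_smul (hπ : IsIrreducibleRep π) (hπ' : IsIrreducibleRep π')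
    {K L : H →L[ℂ] H'} (hK : Intertwines π π' K) (hK0 : K ≠ 0) (hL : Intertwines π π' L) :
    ∃ c : ℂ, L = c • K := by
  obtain ⟨a, ha⟩ := hπ.exists_eq_smul_one (hK.adjoint_comp hL)
  obtain ⟨b, hb⟩ := hπ'.exists_eq_smul_one (hK.adjoint.adjoint_comp hK.adjoint)
  rw [ContinuousLinearMap.adjoint_adjoint] at hb
  have hb0 : b ≠ 0 := by
    rintro rfl
    apply hK0
    ext v
    have h1 : ∀ w, ContinuousLinearMap.adjoint K w = 0 := fun w => by
      have : ⟪K (ContinuousLinearMap.adjoint K w), w⟫_ℂ = 0 := by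
        change ⟪(K ∘L ContinuousLinearMap.adjoint K) w, w⟫_ℂ = 0
        rw [hb]
        simp
      rwa [← ContinuousLinearMap.adjoint_inner_right, inner_self_eq_zero] at this
    refine ext_inner_right ℂ fun w => ?_
    rw [← ContinuousLinearMap.adjoint_inner_right, h1]
    simp
  refine ⟨b⁻¹ * a, ?_⟩
  have h2 : b • L = a • K := by
    have h3 : (K ∘L ContinuousLinearMap.adjoint K) ∘L L =
      K ∘L (ContinuousLinearMap.adjoint K ∘L L) := rfl
    rw [ha, hb] at h3
    ext v
    have := congrArg (fun f : H →L[ℂ] H' => f v) h3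
    simpa using this
  rw [mul_smul, ← h2, smul_smul, inv_mul_cancel₀ hb0, one_smul]

end Schur

/-! ### Intertwiners of doubled representations -/

section TensorIntertwiner

variable {A : Type*} [Ring A] [StarRing A] [Algebra ℂ A]
  {H H' : Type*} [NormedAddCommGroup H] [InnerProductSpace ℂ H]
  [NormedAddCommGroup H'] [InnerProductSpace ℂ H'] [CompleteSpace H']

/-- The operator `η ↦ (⟨ξ'| ⊗ 1) V (ξ ⊗ η)`. -/
def sliceRight (V : HilbertTensor H H →L[ℂ] HilbertTensor H' H') (ξ : H) (ξ' : H') : H →L[ℂ] H' :=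
  ContinuousLinearMap.adjoint (tensorLeft H' ξ') ∘L V ∘L tensorLeft H ξ

/-- The operator `ξ ↦ (1 ⊗ ⟨η'|) V (ξ ⊗ η)`. -/
def sliceLeft (V : HilbertTensor H H →L[ℂ] HilbertTensor H' H') (η : H) (η' : H') : H →L[ℂ] H' :=
  ContinuousLinearMap.adjoint (tensorRight H' η') ∘L V ∘L tensorRight H η

theorem inner_sliceRight (V : HilbertTensor H H →L[ℂ] HilbertTensor H' H') (ξ η : H) (ξ' η' : H') :
    ⟪η', sliceRight V ξ ξ' η⟫_ℂ = ⟪tensorVec ξ' η', V (tensorVec ξ η)⟫_ℂ :=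
  ContinuousLinearMap.adjoint_inner_right (tensorLeft H' ξ') η' (V (tensorVec ξ η))

theorem inner_sliceLeft (V : HilbertTensor H H →L[ℂ] HilbertTensor H' H') (ξ η : H) (ξ' η' : H') :
    ⟪ξ', sliceLeft V η η' ξ⟫_ℂ = ⟪tensorVec ξ' η', V (tensorVec ξ η)⟫_ℂ :=
  ContinuousLinearMap.adjoint_inner_right (tensorRight H' η') ξ' (V (tensorVec ξ η))

variable [CompleteSpace H] {π : A →⋆ₐ[ℂ] (H →L[ℂ] H)} {π' : A →⋆ₐ[ℂ] (H' →L[ℂ] H')}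
  {V : HilbertTensor H H →L[ℂ] HilbertTensor H' H'}

theorem intertwines_sliceRight
    (hV : ∀ a, V ∘L tensorOp (.id ℂ H) (π a) = tensorOp (.id ℂ H') (π' a) ∘L V) (ξ : H) (ξ' : H') :
    Intertwines π π' (sliceRight V ξ ξ') := fun a => by
  ext η
  refine ext_inner_left ℂ fun η' => ?_
  have h := congrArg (fun f => ⟪tensorVec ξ' η', f (tensorVec ξ η)⟫_ℂ) (hV a)
  simp only [ContinuousLinearMap.comp_apply, tensorOp_tensorVec, inner_tensorVec_tensorOp] at h
  rw [ContinuousLinearMap.comp_apply, inner_sliceRight, ContinuousLinearMap.comp_apply,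
    ← ContinuousLinearMap.adjoint_inner_left (π' a), inner_sliceRight]
  simpa [ContinuousLinearMap.adjoint_id] using h

theorem intertwines_sliceLeft
    (hV : ∀ a, V ∘L tensorOp (π a) (.id ℂ H) = tensorOp (π' a) (.id ℂ H') ∘L V) (η : H) (η' : H') :
    Intertwines π π' (sliceLeft V η η') := fun a => by
  ext ξ
  refine ext_inner_left ℂ fun ξ' => ?_
  have h := congrArg (fun f => ⟪tensorVec ξ' η', f (tensorVec ξ η)⟫_ℂ) (hV a)
  simp only [ContinuousLinearMap.comp_apply, tensorOp_tensorVec, inner_tensorVec_tensorOp] at h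
  rw [ContinuousLinearMap.comp_apply, inner_sliceLeft, ContinuousLinearMap.comp_apply,
    ← ContinuousLinearMap.adjoint_inner_left (π' a), inner_sliceLeft]
  simpa [ContinuousLinearMap.adjoint_id] using h

/-- Freezing one tensor factor of `V` leaves an intertwiner on the other, hence a multiple of `K`.
Applied on both sides, this shows that the matrix elements of `V` are a product of those of `K`; the
constant is normalized at a vector `v` with `K v ≠ 0`. -/
theorem exists_eq_smul_tensorOp (hπ : IsIrreducibleRep π) (hπ' : IsIrreducibleRep π')
    (hR : ∀ a, V ∘L tensorOp (.id ℂ H) (π a) = tensorOp (.id ℂ H') (π' a) ∘L V)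
    (hL : ∀ a, V ∘L tensorOp (π a) (.id ℂ H) = tensorOp (π' a) (.id ℂ H') ∘L V)
    {K : H →L[ℂ] H'} (hK : Intertwines π π' K) (hK0 : K ≠ 0) :
    ∃ c : ℂ, V = c • tensorOp K K := by
  obtain ⟨v, hv⟩ : ∃ v, K v ≠ 0 := by
    by_contra! h
    exact hK0 (ContinuousLinearMap.ext h)
  choose f hf using fun ξ ξ' => hK.exists_eq_smul hπ hπ' hK0 (intertwines_sliceRight hR ξ ξ')
  obtain ⟨c, hc⟩ := hK.exists_eq_smul hπ hπ' hK0 (intertwines_sliceLeft hL v (K v))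
  have hn : ⟪K v, K v⟫_ℂ ≠ 0 := inner_self_ne_zero.mpr hv
  refine ⟨c / ⟪K v, K v⟫_ℂ, clm_ext_tensorVec fun ξ η => ext_inner_tensorVec fun ξ' η' => ?_⟩
  have h1 : f ξ ξ' * ⟪K v, K v⟫_ℂ = c * ⟪ξ', K ξ⟫_ℂ := by
    have h2 := inner_sliceRight V ξ v ξ' (K v)
    rw [← inner_sliceLeft, hf, hc] at h2
    simpa [inner_smul_right] using h2
  rw [← inner_sliceRight, hf, smul_apply, smul_apply,
    tensorOp_tensorVec, inner_smul_right, inner_smul_right, inner_tensorVec, ← mul_assoc,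
    eq_div_of_mul_eq hn h1]
  ring

end TensorIntertwiner

/-! ### Uniqueness of the GNS triple -/

section GNS

variable {A : Type*} [Ring A] [StarRing A] [Algebra ℂ A] {φ : A →ₗ[ℂ] ℂ}
  {H H' : Type*} [NormedAddCommGroup H] [InnerProductSpace ℂ H] [CompleteSpace H]
  [NormedAddCommGroup H'] [InnerProductSpace ℂ H']
  {π : A →⋆ₐ[ℂ] (H →L[ℂ] H)} {Ω : H}

theorem IsGNSTriple.norm_sq (h : IsGNSTriple φ π Ω) (a : A) :
    ((‖π a Ω‖ ^ 2 : ℝ) : ℂ) = φ (star a * a) := by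
  rw [← h.inner_eq, map_mul, map_star, ContinuousLinearMap.star_eq_adjoint]
  change _ = ⟪Ω, ContinuousLinearMap.adjoint (π a) (π a Ω)⟫_ℂ
  rw [ContinuousLinearMap.adjoint_inner_right, inner_self_eq_norm_sq_to_K]
  simp

theorem IsGNSTriple.clm_ext (h : IsGNSTriple φ π Ω) {f g : H →L[ℂ] H'}
    (hfg : ∀ a, f (π a Ω) = g (π a Ω)) : f = g := by
  refine DFunLike.coe_injective (f.continuous.ext_on h.cyclic g.continuous ?_)
  rintro _ ⟨a, rfl⟩
  exact hfg a

variable [CompleteSpace H'] {π' : A →⋆ₐ[ℂ] (H' →L[ℂ] H')} {Ω' : H'}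

theorem IsGNSTriple.norm_eq (h : IsGNSTriple φ π Ω) (h' : IsGNSTriple φ π' Ω') (a : A) :
    ‖π a Ω‖ = ‖π' a Ω'‖ := by
  have := (h.norm_sq a).trans (h'.norm_sq a).symm
  rw [Complex.ofReal_inj] at this
  exact (sq_eq_sq₀ (norm_nonneg _) (norm_nonneg _)).mp this

theorem IsGNSTriple.comp_eq_of_forall (h : IsGNSTriple φ π Ω) {U : H →L[ℂ] H'}
    (hU : ∀ a, U (π a Ω) = π' a Ω') (a : A) : U ∘L π a = π' a ∘L U := by
  refine h.clm_ext fun b => ?_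
  change U ((π a * π b) Ω) = π' a (U (π b Ω))
  rw [← map_mul, hU, hU, map_mul]
  rfl

/-- Two GNS triples of the same functional are connected by a bounded intertwiner. -/
theorem IsGNSTriple.exists_intertwiner (h : IsGNSTriple φ π Ω) (h' : IsGNSTriple φ π' Ω') :
    ∃ V : H →L[ℂ] H', ∀ a, V (π a Ω) = π' a Ω' := by
  let e : A →ₗ[ℂ] H := (ContinuousLinearMap.apply ℂ H Ω).toLinearMap ∘ₗ π.toLinearMap
  let f : A →ₗ[ℂ] H' := (ContinuousLinearMap.apply ℂ H' Ω').toLinearMap ∘ₗ π'.toLinearMap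
  -- Since `‖π a Ω‖ = ‖π' a Ω'‖`, the assignment `π a Ω ↦ π' a Ω'` is well defined and bounded on a
  -- dense subspace.
  refine ⟨f.extendOfNorm e, fun a => ?_⟩
  exact LinearMap.extendOfNorm_eq (f := f) (e := e) h.cyclic
    ⟨1, fun x => by rw [one_mul]; exact (h.norm_eq h' x).ge⟩ a

end GNS

/-! ### The reflection index is a well-defined sign -/

namespace SpinChain

variable {d : ℕ} {H : Type*} [NormedAddCommGroup H] [InnerProductSpace ℂ H] [CompleteSpace H]
  {ω : Chain d →ₗ[ℂ] ℂ} {π : ChainR d →⋆ₐ[ℂ] (H →L[ℂ] H)}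
  {ρ : Chain d →⋆ₐ[ℂ] (HilbertTensor H H →L[ℂ] HilbertTensor H H)}
  {Ω : HilbertTensor H H} {Γ : HilbertTensor H H ≃ₗᵢ[ℂ] HilbertTensor H H}

/-- The inverse `𝒜_R → 𝒜_L` of the reflection `γ_{L → R}`. -/
def reflectionRL (d : ℕ) : ChainR d →⋆ₐ[ℂ] ChainL d :=
  reflHom d (Set.Ici 0) (Set.Iic (-1)) fun j hj => by
    simp only [Set.mem_Iic, Set.mem_Ici, refl] at *
    omega

theorem reflection_inclR (a : ChainR d) :
    reflection d (inclR d a) = inclL d (reflectionRL d a) := by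
  refine Subtype.ext ?_
  rw [coe_inclL, reflection, reflectionRL, coe_reflHom, coe_reflHom, coe_inclR]

theorem reflectionLR_reflectionRL (a : ChainR d) : reflectionLR d (reflectionRL d a) = a := by
  have h : inclR d (reflectionLR d (reflectionRL d a)) = inclR d a := by
    rw [← reflection_inclL, ← reflection_inclR, reflection_reflection]
  refine Subtype.ext ?_
  rw [← coe_inclR, h, coe_inclR]

theorem IsDoubledRep.apply_inclR (h : IsDoubledRep π ρ) (b : ChainR d) :
    ρ (inclR d b) = tensorOp (.id ℂ H) (π b) := by
  have h1 := h 1 b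
  rw [map_one, one_mul, map_one, map_one] at h1
  exact h1

theorem IsDoubledRep.apply_inclL (h : IsDoubledRep π ρ) (b : ChainR d) :
    ρ (inclL d (reflectionRL d b)) = tensorOp (π b) (.id ℂ H) := by
  have h1 := h (reflectionRL d b) 1
  rw [map_one, mul_one, map_one, reflectionLR_reflectionRL] at h1
  exact h1

/-- `Γ` exchanges the two half-chains and so does the flip; their composite commutes with both
tensor factors, so `exists_eq_smul_tensorOp` with `K = 1` makes it a scalar. -/
theorem IsReflectionSplitRep.exists_smul_tensorVec (h : IsReflectionSplitRep ω π Ω Γ) :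
    ∃ σ : ℂ, ∀ ξ η : H, Γ (tensorVec ξ η) = σ • tensorVec η ξ := by
  obtain ⟨ρ, hρ, hgns, hΓ⟩ := h.exists_rep
  have := h.irreducible.nontrivial
  have hint := hgns.comp_eq_of_forall (π' := ρ.comp (reflection d))
    (U := (Γ : HilbertTensor H H →L[ℂ] HilbertTensor H H)) hΓ
  have hR : ∀ a, ((Γ : HilbertTensor H H →L[ℂ] HilbertTensor H H) ∘L tensorFlip H H) ∘L
      tensorOp (.id ℂ H) (π a) = tensorOp (.id ℂ H) (π a) ∘L
        ((Γ : HilbertTensor H H →L[ℂ] HilbertTensor H H) ∘L tensorFlip H H) := fun a => by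
    have h1 := hint (inclL d (reflectionRL d a))
    rw [StarAlgHom.comp_apply] at h1
    rw [reflection_inclL, hρ.apply_inclL, reflectionLR_reflectionRL, hρ.apply_inclR] at h1
    refine clm_ext_tensorVec fun ξ η => ?_
    have h2 := congrArg (fun f => f (tensorVec η ξ)) h1
    simpa [tensorOp_tensorVec] using h2
  have hL : ∀ a, ((Γ : HilbertTensor H H →L[ℂ] HilbertTensor H H) ∘L tensorFlip H H) ∘L
      tensorOp (π a) (.id ℂ H) = tensorOp (π a) (.id ℂ H) ∘L
        ((Γ : HilbertTensor H H →L[ℂ] HilbertTensor H H) ∘L tensorFlip H H) := fun a => by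
    have h1 := hint (inclR d a)
    rw [StarAlgHom.comp_apply] at h1
    rw [reflection_inclR, hρ.apply_inclL, hρ.apply_inclR] at h1
    refine clm_ext_tensorVec fun ξ η => ?_
    have h2 := congrArg (fun f => f (tensorVec η ξ)) h1
    simpa [tensorOp_tensorVec] using h2
  obtain ⟨c, hc⟩ := exists_eq_smul_tensorOp h.irreducible h.irreducible hR hL
    (K := .id ℂ H) (fun a => rfl) one_ne_zero
  refine ⟨c, fun ξ η => ?_⟩
  have h1 := congrArg (fun f => f (tensorVec η ξ)) hc
  simpa [tensorOp_tensorVec] using h1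

theorem IsReflectionSplitRep.apply_apply (h : IsReflectionSplitRep ω π Ω Γ)
    (Φ : HilbertTensor H H) : Γ (Γ Φ) = Φ := by
  obtain ⟨ρ, hρ, hgns, hΓ⟩ := h.exists_rep
  have h1 : (Γ : HilbertTensor H H →L[ℂ] HilbertTensor H H) ∘L
      (Γ : HilbertTensor H H →L[ℂ] HilbertTensor H H) = .id ℂ _ := hgns.clm_ext fun a => by
    change Γ (Γ (ρ a Ω)) = ρ a Ω
    rw [hΓ, hΓ, reflection_reflection]
  exact congrArg (fun f => f Φ) h1

theorem IsReflectionSplitRep.apply_vector (h : IsReflectionSplitRep ω π Ω Γ) : Γ Ω = Ω := by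
  obtain ⟨ρ, hρ, hgns, hΓ⟩ := h.exists_rep
  simpa using hΓ 1

theorem exists_tensorVec_self_ne_zero (h : IsReflectionSplitRep ω π Ω Γ) :
    ∃ v : H, tensorVec v v ≠ 0 := by
  have := h.irreducible.nontrivial
  obtain ⟨v, hv⟩ := exists_ne (0 : H)
  exact ⟨v, fun h0 => hv (by simpa [norm_tensorVec] using congrArg norm h0)⟩

theorem IsReflectionSplitRep.exists_sign (h : IsReflectionSplitRep ω π Ω Γ) :
    ∃ σ : ℤ, (σ = 1 ∨ σ = -1) ∧ ∀ ξ η : H, Γ (tensorVec ξ η) = σ • tensorVec η ξ := by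
  obtain ⟨c, hc⟩ := h.exists_smul_tensorVec
  obtain ⟨v, hv⟩ := exists_tensorVec_self_ne_zero h
  have h1 := h.apply_apply (tensorVec v v)
  rw [hc, map_smul, hc, smul_smul] at h1
  have h2 : c * c = 1 := by
    have h3 : (c * c - 1) • tensorVec v v = 0 := by rw [sub_smul, h1, one_smul, sub_self]
    exact sub_eq_zero.mp ((smul_eq_zero.mp h3).resolve_right hv)
  rcases mul_self_eq_one_iff.mp h2 with rfl | rfl
  · exact ⟨1, .inl rfl, fun ξ η => by rw [hc, one_smul, one_smul]⟩
  · exact ⟨-1, .inr rfl, fun ξ η => by rw [hc, neg_smul, neg_smul, one_smul, one_smul]⟩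

/-- The intertwiner `V` of the two GNS triples satisfies `V Γ = Γ' V` and equals `c • (K ⊗ K)`. On
`v ⊗ v` with `w = K v ≠ 0` both flips act trivially, leaving `σ c (w ⊗ w) = σ' c (w ⊗ w)`. -/
theorem IsReflectionSplitRep.sign_unique {H' : Type*} [NormedAddCommGroup H']
    [InnerProductSpace ℂ H'] [CompleteSpace H'] {π' : ChainR d →⋆ₐ[ℂ] (H' →L[ℂ] H')}
    {Ω' : HilbertTensor H' H'} {Γ' : HilbertTensor H' H' ≃ₗᵢ[ℂ] HilbertTensor H' H'}
    (h : IsReflectionSplitRep ω π Ω Γ) (h' : IsReflectionSplitRep ω π' Ω' Γ') {σ σ' : ℤ}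
    (hσ : ∀ ξ η : H, Γ (tensorVec ξ η) = σ • tensorVec η ξ)
    (hσ' : ∀ ξ η : H', Γ' (tensorVec ξ η) = σ' • tensorVec η ξ) : σ = σ' := by
  obtain ⟨ρ, hρ, hgns, hΓ⟩ := h.exists_rep
  obtain ⟨ρ', hρ', hgns', hΓ'⟩ := h'.exists_rep
  obtain ⟨V, hV⟩ := hgns.exists_intertwiner hgns'
  have hVρ : ∀ a, V ∘L ρ a = ρ' a ∘L V := hgns.comp_eq_of_forall hV
  have hVΓ : V ∘L (Γ : HilbertTensor H H →L[ℂ] HilbertTensor H H) =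
      (Γ' : HilbertTensor H' H' →L[ℂ] HilbertTensor H' H') ∘L V := hgns.clm_ext fun b => by
    change V (Γ (ρ b Ω)) = Γ' (V (ρ b Ω))
    rw [hΓ, hV, hV, hΓ']
  have hR : ∀ a, V ∘L tensorOp (.id ℂ H) (π a) = tensorOp (.id ℂ H') (π' a) ∘L V := fun a => by
    rw [← hρ.apply_inclR, ← hρ'.apply_inclR, hVρ]
  have hL : ∀ a, V ∘L tensorOp (π a) (.id ℂ H) = tensorOp (π' a) (.id ℂ H') ∘L V := fun a => by
    rw [← hρ.apply_inclL, ← hρ'.apply_inclL, hVρ]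
  have hV0 : V ≠ 0 := by
    rintro rfl
    have h1 := hV 1
    rw [map_one, map_one] at h1
    have h2 := h'.norm_eq_one
    rw [show Ω' = 0 from h1.symm, norm_zero] at h2
    exact zero_ne_one h2
  obtain ⟨ξ, ξ', hK⟩ : ∃ ξ ξ', sliceRight V ξ ξ' ≠ 0 := by
    by_contra! h0
    refine hV0 (clm_ext_tensorVec fun ξ η => ext_inner_tensorVec fun ξ' η' => ?_)
    rw [← inner_sliceRight, h0]
    simp
  obtain ⟨c, hc⟩ := exists_eq_smul_tensorOp h.irreducible h'.irreducible hR hL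
    (intertwines_sliceRight hR ξ ξ') hK
  obtain ⟨v, hv⟩ : ∃ v, sliceRight V ξ ξ' v ≠ 0 := by
    by_contra! h0
    exact hK (ContinuousLinearMap.ext h0)
  set w := sliceRight V ξ ξ' v with hw
  have hVv : V (tensorVec v v) = c • tensorVec w w := by
    rw [hc]
    exact congrArg (c • ·) (tensorOp_tensorVec _ _ v v)
  have hc0 : c ≠ 0 := by
    rintro rfl
    exact hV0 (hc.trans (zero_smul _ _))
  have h1 : V (Γ (tensorVec v v)) = Γ' (V (tensorVec v v)) :=
    congrArg (fun f => f (tensorVec v v)) hVΓ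
  rw [hσ, map_zsmul, hVv, map_smul, hσ', ← Int.cast_smul_eq_zsmul ℂ σ,
    ← Int.cast_smul_eq_zsmul ℂ σ', smul_smul, smul_smul] at h1
  have h2 : (((σ : ℂ) - σ') * c) • tensorVec w w = 0 := by
    rw [sub_mul, sub_smul, h1, mul_comm, sub_self]
  have h3 : tensorVec w w ≠ 0 := fun h0 => hv (by simpa [norm_tensorVec] using congrArg norm h0)
  have h4 := (mul_eq_zero.mp ((smul_eq_zero.mp h2).resolve_right h3)).resolve_right hc0
  exact_mod_cast sub_eq_zero.mp h4

end SpinChain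

section

variable {d : ℕ} {H : Type u} [NormedAddCommGroup H] [InnerProductSpace ℂ H] [CompleteSpace H]
  {ω : SpinChain.Chain d →ₗ[ℂ] ℂ} {π : SpinChain.ChainR d →⋆ₐ[ℂ] (H →L[ℂ] H)}
  {Ω : HilbertTensor H H} {Γ : HilbertTensor H H ≃ₗᵢ[ℂ] HilbertTensor H H}

theorem SpinChain.IsReflectionSplitRep.isReflectionIndex
    (h : SpinChain.IsReflectionSplitRep ω π Ω Γ) :
    SpinChain.IsReflectionIndex.{u} ω (SpinChain.reflectionIndex.{u} ω) := by
  refine Classical.epsilon_spec (p := SpinChain.IsReflectionIndex.{u} ω) ?_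
  obtain ⟨σ, hσ, hσΓ⟩ := h.exists_sign
  refine ⟨σ, hσ, fun H' _ _ _ π' Ω' Γ' h' => ?_⟩
  obtain ⟨σ', -, hσΓ'⟩ := h'.exists_sign
  rwa [h.sign_unique h' hσΓ hσΓ']

end

/-! ### Anti-unitaries, positive self-adjoint operators and the modular conjugation -/

section AntiunitaryInner

variable {K : Type*} [NormedAddCommGroup K] [InnerProductSpace ℂ K]

theorem antiunitary_inner_map_map (θ : K ≃ₗᵢ⋆[ℂ] K) (x y : K) : ⟪θ x, θ y⟫_ℂ = ⟪y, x⟫_ℂ := by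
  have hI : θ ((RCLike.I : ℂ) • y) = -((RCLike.I : ℂ) • θ y) := by
    rw [map_smulₛₗ]
    simp
  have h1 : ‖θ x - (RCLike.I : ℂ) • θ y‖ = ‖x + (RCLike.I : ℂ) • y‖ := by
    rw [← θ.norm_map (x + _), map_add, hI, sub_eq_add_neg]
  have h2 : ‖θ x + (RCLike.I : ℂ) • θ y‖ = ‖x - (RCLike.I : ℂ) • y‖ := by
    rw [← θ.norm_map (x - _), map_sub, hI, sub_neg_eq_add]
  rw [← inner_conj_symm y x, inner_eq_sum_norm_sq_div_four (θ x), inner_eq_sum_norm_sq_div_four x,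
    ← map_add, ← map_sub, θ.norm_map, θ.norm_map, h1, h2]
  have h4 : starRingEnd ℂ 4 = 4 := map_ofNat _ 4
  simp [h4]
  ring

end AntiunitaryInner

section Modular

variable {H : Type*} [NormedAddCommGroup H] [InnerProductSpace ℂ H] [CompleteSpace H]

theorem LinearPMap.mem_domain_of_isSelfAdjoint {D : H →ₗ.[ℂ] H} (hD : IsSelfAdjoint D) {y z : H}
    (h : ∀ x : D.domain, ⟪z, x⟫_ℂ = ⟪y, D x⟫_ℂ) : ∃ hy : y ∈ D.domain, D ⟨y, hy⟩ = z := by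
  have hdom : y ∈ D.adjoint.domain := LinearPMap.mem_adjoint_domain_of_exists y ⟨z, h⟩
  have happ : D.adjoint ⟨y, hdom⟩ = z := LinearPMap.adjoint_apply_eq hD.dense_domain ⟨y, hdom⟩ h
  have hDD : D.adjoint = D := hD
  -- Replacing the adjoint by a variable lets the domain membership and the value be transported
  -- together along `D* = D`.
  generalize D.adjoint = D' at *
  subst hDD
  exact ⟨hdom, happ⟩

/-- A positive self-adjoint operator `D` has `D v = t v` if `⟪D v, D w⟫ = t² ⟪v, w⟫` for all `w`. -/
theorem LinearPMap.apply_eq_smul_of_inner {D : H →ₗ.[ℂ] H} (hD : IsSelfAdjoint D)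
    (hpos : ∀ v : D.domain, 0 ≤ ⟪(v : H), D v⟫_ℂ) {t : ℝ} (ht : 0 < t) (v : D.domain)
    (h : ∀ w : D.domain, ⟪D v, D w⟫_ℂ = (t : ℂ) ^ 2 * ⟪(v : H), w⟫_ℂ) :
    D v = (t : ℂ) • (v : H) := by
  obtain ⟨hDv, hDDv⟩ := LinearPMap.mem_domain_of_isSelfAdjoint hD (y := D v)
    (z := (t : ℂ) ^ 2 • (v : H)) fun w => by
      rw [h, inner_smul_left]
      simp
  -- `D² v = t² v` gives `(D + t)(D - t) v = 0`, so `u = (D - t) v` satisfies `D u = -t u`;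
  -- positivity of `D` then leaves only `u = 0`.
  let u : D.domain := ⟨D v, hDv⟩ - (t : ℂ) • v
  have hu : D u = -((t : ℂ) • (u : H)) := by
    change D (⟨D v, hDv⟩ - (t : ℂ) • v) = -((t : ℂ) • (D v - (t : ℂ) • (v : H)))
    rw [LinearPMap.map_sub, LinearPMap.map_smul, hDDv]
    module
  have h1 := hpos u
  rw [hu, inner_neg_right, inner_smul_right, inner_self_eq_norm_sq_to_K] at h1
  have h2 : t * ‖(u : H)‖ ^ 2 ≤ 0 := by
    have h3 : (0 : ℂ) ≤ ((-(t * ‖(u : H)‖ ^ 2) : ℝ) : ℂ) := by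
      push_cast
      exact h1
    have h4 := Complex.zero_le_real.mp h3
    linarith
  have h5 : ‖(u : H)‖ = 0 := by
    by_contra h0
    have : 0 < t * ‖(u : H)‖ ^ 2 := by positivity
    linarith
  exact sub_eq_zero.mp (norm_eq_zero.mp h5)

/-- The modular conjugation on an eigenvector of `Δ`. -/
theorem IsModularConjugation.smul_apply_eq {M : Set (H →L[ℂ] H)} {Ω : H} {J : H ≃ₗᵢ⋆[ℂ] H}
    (hJ : IsModularConjugation M Ω J) {v w : H} {t : ℝ} (ht : 0 < t)
    (hv : (v, w) ∈ tomitaGraph M Ω)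
    (h : ∀ x ∈ M, ⟪ContinuousLinearMap.adjoint x Ω, w⟫_ℂ = (t : ℂ) ^ 2 * ⟪v, x Ω⟫_ℂ) :
    (t : ℂ) • J v = w := by
  obtain ⟨D, hD, hpos, hgraph⟩ := hJ
  have hmem : (v, w) ∈ closure (tomitaGraph M Ω) := subset_closure hv
  rw [hgraph] at hmem
  obtain ⟨v', hv'⟩ := hmem
  obtain ⟨rfl, rfl⟩ := Prod.mk.inj hv'
  -- The hypothesis is a closed condition on pairs, so it passes from `(x Ω, x* Ω)` to the closure
  -- of the graph. At a point `(u, J D u)` the anti-unitarity of `J` turns it into `⟪D v, D u⟫ = t²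
  -- ⟪v, u⟫`.
  have hcl : IsClosed {p : H × H | ⟪p.2, J (D v')⟫_ℂ = (t : ℂ) ^ 2 * ⟪(v' : H), p.1⟫_ℂ} :=
    isClosed_eq (by fun_prop) (by fun_prop)
  have hsub : closure (tomitaGraph M Ω) ⊆
      {p : H × H | ⟪p.2, J (D v')⟫_ℂ = (t : ℂ) ^ 2 * ⟪(v' : H), p.1⟫_ℂ} := by
    refine closure_minimal ?_ hcl
    rintro _ ⟨x, hx, rfl⟩
    exact h x hx
  have key := LinearPMap.apply_eq_smul_of_inner hD hpos ht v' fun u => by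
    have hu : ((u : H), J (D u)) ∈ closure (tomitaGraph M Ω) := by
      rw [hgraph]
      exact ⟨u, rfl⟩
    have h1 : ⟪J (D u), J (D v')⟫_ℂ = _ := hsub hu
    rw [← h1, antiunitary_inner_map_map]
  rw [key, map_smulₛₗ]
  simp

end Modular

/-! ### Hilbert bases and diagonalization of compact symmetric operators -/

section AntiunitaryBasics

variable {K : Type*} [NormedAddCommGroup K] [InnerProductSpace ℂ K]

/-- The anti-unitary that takes one Hilbert basis to another one. -/
def antiunitaryOfBases {ι : Type*} (b b' : HilbertBasis ι ℂ K) : K ≃ₗᵢ⋆[ℂ] K :=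
  (b.repr.trans (starₗᵢ ℂ)).trans b'.repr.symm

theorem antiunitaryOfBases_apply {ι : Type*} (b b' : HilbertBasis ι ℂ K) (k : ι) :
    antiunitaryOfBases b b' (b k) = b' k := by
  classical
  change b'.repr.symm (star (b.repr (b k))) = b' k
  rw [b.repr_self, ← b'.repr_symm_single]
  congr 1
  ext j
  rw [lp.star_apply]
  by_cases h : j = k
  · subst h
    simp
  · simp [h]

theorem HilbertBasis.ext_inner {ι : Type*} (b : HilbertBasis ι ℂ K) {x y : K}
    (h : ∀ k, ⟪b k, x⟫_ℂ = ⟪b k, y⟫_ℂ) : x = y :=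
  b.repr.injective <| lp.ext <| funext fun k => by
    rw [b.repr_apply_apply, b.repr_apply_apply, h]

theorem HilbertBasis.ext_clm {ι : Type*} (b : HilbertBasis ι ℂ K) {σ : ℂ →+* ℂ} {G : Type*}
    [NormedAddCommGroup G] [NormedSpace ℂ G] {f g : K →SL[σ] G} (h : ∀ k, f (b k) = g (b k)) :
    f = g := by
  refine ContinuousLinearMap.ext_on
    (Submodule.dense_iff_topologicalClosure_eq_top.mpr b.dense_span) ?_
  rintro _ ⟨k, rfl⟩
  exact h k

end AntiunitaryBasics

section Spectral

variable {K : Type u} [NormedAddCommGroup K] [InnerProductSpace ℂ K] [CompleteSpace K]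

/-- Orthonormal bases of all eigenspaces, the kernel included, are glued together: the eigenspaces
are mutually orthogonal and the complement of their sum is zero by the spectral theorem. -/
theorem exists_hilbertBasis_of_isCompactOperator {T : K →L[ℂ] K} (hT : IsCompactOperator T)
    (hs : T.IsSymmetric) : ∃ (ι : Type u) (b : HilbertBasis ι ℂ K) (μ : ι → ℂ),
      ∀ i, T (b i) = μ i • b i := by
  let V : ℂ → Submodule ℂ K := Module.End.eigenspace (T : Module.End ℂ K)
  have hcl : ∀ μ, IsClosed (V μ : Set K) := fun μ => by
    have : (V μ : Set K) = {x | T x = μ • x} := by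
      ext x
      exact Module.End.mem_eigenspace_iff
    rw [this]
    exact isClosed_eq T.continuous (continuous_const_smul μ)
  have hcomp : ∀ μ, CompleteSpace (V μ) := fun μ => (hcl μ).completeSpace_coe
  choose w b hb using fun μ => exists_hilbertBasis ℂ (V μ)
  have ho : Orthonormal ℂ fun a : Σ μ, w μ => (b a.1 a.2 : K) := (LinearMap.IsSymmetric.orthogonalFamily_eigenspaces hs).orthonormal_sigma_orthonormal
      fun μ => (b μ).orthonormal
  have hsp : (Submodule.span ℂ (Set.range fun a : Σ μ, w μ => (b a.1 a.2 : K)))ᗮ = ⊥ := by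
    rw [eq_bot_iff, ← ContinuousLinearMap.orthogonalComplement_iSup_eigenspaces_eq_bot hT hs]
    intro x hx
    rw [Submodule.mem_orthogonal] at hx ⊢
    have h1 : (⨆ μ, V μ) ≤ (Submodule.span ℂ {x})ᗮ := by
      refine iSup_le fun μ y hy => ?_
      rw [Submodule.mem_orthogonal_singleton_iff_inner_right]
      have h2 : (innerSL ℂ x).comp (V μ).subtypeL = 0 := (b μ).ext_clm fun k => by
        have := hx _ (Submodule.subset_span ⟨⟨μ, k⟩, rfl⟩)
        simpa using inner_eq_zero_symm.mp this
      exact congrArg (fun f => f ⟨y, hy⟩) h2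
    intro u hu
    exact inner_eq_zero_symm.mp (Submodule.mem_orthogonal_singleton_iff_inner_right.mp (h1 hu))
  refine ⟨Σ μ, w μ, HilbertBasis.mkOfOrthogonalEqBot ho hsp, fun a => a.1, fun a => ?_⟩
  rw [HilbertBasis.coe_mkOfOrthogonalEqBot]
  exact Module.End.mem_eigenspace_iff.mp (b a.1 a.2).2

end Spectral

/-! ### Antilinear operators with `T* = σ T` and their polar decomposition -/

/-- The antilinear operator `T` is injective and satisfies `T* = σ T` with a sign `σ`. -/
structure IsSignedAntiOp {K : Type*} [NormedAddCommGroup K] [InnerProductSpace ℂ K]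
    (T : K →L⋆[ℂ] K) (σ : ℤ) : Prop where
  sign : σ = 1 ∨ σ = -1
  symm : ∀ ξ η, ⟪ξ, T η⟫_ℂ = σ * ⟪η, T ξ⟫_ℂ
  inj : ∀ η, T η = 0 → η = 0

/-- A singular value decomposition of an antilinear operator. -/
def IsSchmidt {K : Type*} [NormedAddCommGroup K] [InnerProductSpace ℂ K] {ι : Type*}
    (T : K →L⋆[ℂ] K) (b b' : HilbertBasis ι ℂ K) (r : ι → ℝ) : Prop :=
  ∀ k, 0 < r k ∧ T (b k) = (r k : ℂ) • b' k

namespace IsSignedAntiOp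

section

variable {K : Type*} [NormedAddCommGroup K] [InnerProductSpace ℂ K] {T : K →L⋆[ℂ] K} {σ : ℤ}

theorem sign_mul_self (hT : IsSignedAntiOp T σ) : (σ : ℂ) * σ = 1 := by
  rcases hT.sign with rfl | rfl <;> simp

variable {ι : Type*} {b b' : HilbertBasis ι ℂ K} {r : ι → ℝ}

theorem apply_basis (hT : IsSignedAntiOp T σ) (h : IsSchmidt T b b' r) (k : ι) :
    T (b' k) = ((σ : ℂ) * r k) • b k := by
  classical
  refine b.ext_inner fun j => ?_
  rw [hT.symm, (h j).2, inner_smul_right, inner_smul_right, orthonormal_iff_ite.mp b.orthonormal,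
    orthonormal_iff_ite.mp b'.orthonormal]
  by_cases hjk : j = k
  · subst hjk
    simp
  · simp [hjk, Ne.symm hjk]

/-- The symmetry of `T` tested on `b'` gives `r_j X = σ r_k Y`, and tested on `b` it gives `r_k X =
σ r_j Y`, with `X`, `Y` the two inner products. Adding them, the factor `r_j + r_k > 0` cancels. -/
theorem inner_basis (hT : IsSignedAntiOp T σ) (h : IsSchmidt T b b' r) (j k : ι) :
    ⟪b' k, b j⟫_ℂ = σ * ⟪b' j, b k⟫_ℂ := by
  have h1 : (σ * r j : ℂ) * ⟪b' k, b j⟫_ℂ = σ * ((σ * r k) * ⟪b' j, b k⟫_ℂ) := by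
    have := hT.symm (b' k) (b' j)
    rwa [hT.apply_basis h, hT.apply_basis h, inner_smul_right, inner_smul_right] at this
  have h2 : (r k : ℂ) * ⟪b' k, b j⟫_ℂ = σ * (r j * ⟪b' j, b k⟫_ℂ) := by
    have := congrArg (starRingEnd ℂ) (hT.symm (b j) (b k))
    rw [(h j).2, (h k).2, inner_smul_right, inner_smul_right] at this
    simpa only [map_mul, inner_conj_symm, Complex.conj_ofReal, map_intCast] using this
  have hs := hT.sign_mul_self
  have hpos : ((r j : ℂ) + r k) ≠ 0 := by
    exact_mod_cast (add_pos (h j).1 (h k).1).ne'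
  apply mul_left_cancel₀ hpos
  linear_combination (σ : ℂ) * h1 + h2 + ((r k : ℂ) * σ * ⟪b' j, b k⟫_ℂ
    - (r j : ℂ) * ⟪b' k, b j⟫_ℂ) * hs

/-- The matrix elements of `θ b'_k` in the basis `b'` are those of `σ b_k`, by `inner_basis`. -/
theorem antiunitary_sq (hT : IsSignedAntiOp T σ) (h : IsSchmidt T b b' r) {θ : K ≃ₗᵢ⋆[ℂ] K}
    (hθ : ∀ k, θ (b k) = b' k) (ξ : K) : θ (θ ξ) = σ • ξ := by
  have h1 : ∀ k, θ (b' k) = (σ : ℂ) • b k := fun k => b'.ext_inner fun j => by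
    rw [← hθ j, antiunitary_inner_map_map, hθ j, inner_smul_right, hT.inner_basis h]
  have h2 : (θ : K →L⋆[ℂ] K).comp (θ : K →L⋆[ℂ] K) = (σ : ℂ) • .id ℂ K := b.ext_clm fun k => by
    change θ (θ (b k)) = (σ : ℂ) • b k
    rw [hθ, h1]
  have h3 := congrArg (fun f => f ξ) h2
  rw [← Int.cast_smul_eq_zsmul ℂ σ]
  exact h3

end

variable {K : Type u} [NormedAddCommGroup K] [InnerProductSpace ℂ K] [CompleteSpace K]
  {T : K →L⋆[ℂ] K} {σ : ℤ}

theorem exists_isSchmidt (hT : IsSignedAntiOp T σ) (hc : IsCompactOperator T) :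
    ∃ (ι : Type u) (b b' : HilbertBasis ι ℂ K) (r : ι → ℝ), IsSchmidt T b b' r := by
  -- `σ T² = T* T`, a compact symmetric linear operator. Its eigenbasis is `b`, and `b'` consists of
  -- the normalized vectors `T b_k`.
  let R : K →L[ℂ] K := (σ : ℂ) • T.comp T
  have hR : ∀ x y, ⟪x, R y⟫_ℂ = ⟪T y, T x⟫_ℂ := fun x y => by
    change ⟪x, (σ : ℂ) • T (T y)⟫_ℂ = _
    rw [inner_smul_right, hT.symm, ← mul_assoc, hT.sign_mul_self, one_mul]
  have hRc : IsCompactOperator R := (hc.comp_clm T).smul (σ : ℂ)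
  have hRs : R.IsSymmetric := fun x y => by
    change ⟪R x, y⟫_ℂ = ⟪x, R y⟫_ℂ
    rw [hR, ← inner_conj_symm, hR, inner_conj_symm]
  obtain ⟨ι, b, μ, hb⟩ := exists_hilbertBasis_of_isCompactOperator hRc hRs
  have hr : ∀ k, 0 < ‖T (b k)‖ := fun k => norm_pos_iff.mpr fun h0 => by
    have h1 := b.orthonormal.1 k
    rw [hT.inj _ h0, norm_zero] at h1
    exact zero_ne_one h1
  have ho : Orthonormal ℂ fun k => (‖T (b k)‖ : ℂ)⁻¹ • T (b k) := by
    refine ⟨fun k => ?_, fun i j hij => ?_⟩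
    · rw [norm_smul, norm_inv, Complex.norm_real, norm_norm, inv_mul_cancel₀ (hr k).ne']
    · change ⟪(‖T (b i)‖ : ℂ)⁻¹ • T (b i), (‖T (b j)‖ : ℂ)⁻¹ • T (b j)⟫_ℂ = 0
      rw [inner_smul_left, inner_smul_right, ← hR, hb, inner_smul_right, b.orthonormal.2 hij.symm]
      simp
  have hsp : (Submodule.span ℂ (Set.range fun k => (‖T (b k)‖ : ℂ)⁻¹ • T (b k)))ᗮ = ⊥ := by
    rw [eq_bot_iff]
    intro x hx
    rw [Submodule.mem_orthogonal] at hx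
    -- A vector orthogonal to every `T b_k` is annihilated by `T`, because `T* = σ T`; injectivity
    -- then makes it zero.
    refine hT.inj x (b.ext_inner fun k => ?_)
    have h1 := inner_eq_zero_symm.mp (hx _ (Submodule.subset_span ⟨k, rfl⟩))
    have h2 : ((‖T (b k)‖ : ℂ)⁻¹) ≠ 0 := inv_ne_zero (by exact_mod_cast (hr k).ne')
    rw [inner_smul_right, mul_eq_zero, or_iff_right h2] at h1
    rw [hT.symm, h1, mul_zero, inner_zero_right]
  refine ⟨ι, b, HilbertBasis.mkOfOrthogonalEqBot ho hsp, fun k => ‖T (b k)‖, fun k => ⟨hr k, ?_⟩⟩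
  rw [HilbertBasis.coe_mkOfOrthogonalEqBot, smul_smul, mul_inv_cancel₀, one_smul]
  exact_mod_cast (hr k).ne'

end IsSignedAntiOp

/-! ### Computation of the modular conjugation -/

section ModularFlip

variable {K : Type*} [NormedAddCommGroup K] [InnerProductSpace ℂ K] [CompleteSpace K]
  {Φ : HilbertTensor K K} {σ : ℤ} {J : HilbertTensor K K ≃ₗᵢ⋆[ℂ] HilbertTensor K K}
  {ι : Type*} {b b' : HilbertBasis ι ℂ K} {r : ι → ℝ}

/-- Rank-one operators produce explicit elementary tensors in the Tomita graph. -/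
theorem tensorOp_rankOne_apply (Φ : HilbertTensor K K) (e f : K) :
    tensorOp (.id ℂ K) (InnerProductSpace.rankOne ℂ e f) Φ = tensorVec (antiOp Φ f) e := by
  refine ext_inner_tensorVec fun ξ η => ?_
  rw [inner_tensorVec_tensorOp, InnerProductSpace.adjoint_rankOne, inner_tensorVec, inner_antiOp,
    InnerProductSpace.rankOne_apply, ← tensorLeft_apply, map_smul, inner_smul_left,
    inner_conj_symm, mul_comm]
  simp [ContinuousLinearMap.adjoint_id]

theorem IsModularConjugation.apply_tensorVec_basis
    (hJ : IsModularConjugation (rightFactor K K) Φ J) (hT : IsSignedAntiOp (antiOp Φ) σ)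
    (h : IsSchmidt (antiOp Φ) b b' r) (i j : ι) :
    J (tensorVec (b' j) (b i)) = tensorVec (b' i) (b j) := by
  have hi : (r i : ℂ) ≠ 0 := by exact_mod_cast (h i).1.ne'
  have hj : (r j : ℂ) ≠ 0 := by exact_mod_cast (h j).1.ne'
  have hs := hT.sign_mul_self
  -- With `x = |b_i⟩⟨b_j|` one has `x Φ = T b_j ⊗ b_i` and `x* Φ = T b_i ⊗ b_j`. The vector `x Φ` is
  -- an eigenvector of `Δ^{1/2}` with eigenvalue `r_i / r_j`, as the inner products with `y Φ` carry
  -- the factors `r_i²` and `r_j²`.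
  have key := hJ.smul_apply_eq (v := tensorVec (antiOp Φ (b j)) (b i))
    (w := tensorVec (antiOp Φ (b i)) (b j)) (div_pos (h i).1 (h j).1)
    ⟨_, ⟨InnerProductSpace.rankOne ℂ (b i) (b j), rfl⟩, by
      rw [adjoint_tensorOp, ContinuousLinearMap.adjoint_id, InnerProductSpace.adjoint_rankOne,
        tensorOp_rankOne_apply, tensorOp_rankOne_apply]⟩ (by
      rintro _ ⟨y, rfl⟩
      have h1 : ⟪ContinuousLinearMap.adjoint (tensorOp (.id ℂ K) y) Φ,
          tensorVec (antiOp Φ (b i)) (b j)⟫_ℂ = (r i : ℂ) ^ 2 * ⟪b i, y (b j)⟫_ℂ := by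
        rw [ContinuousLinearMap.adjoint_inner_left, tensorOp_tensorVec, ← inner_conj_symm]
        change starRingEnd ℂ ⟪tensorVec (antiOp Φ (b i)) (y (b j)), Φ⟫_ℂ = _
        rw [← inner_antiOp, (h i).2, inner_smul_left, hT.symm, hT.apply_basis h,
          inner_smul_right]
        simp only [map_mul, inner_conj_symm, Complex.conj_ofReal, map_intCast]
        linear_combination (r i : ℂ) ^ 2 * ⟪b i, y (b j)⟫_ℂ * hs
      have h2 : ⟪tensorVec (antiOp Φ (b j)) (b i), tensorOp (.id ℂ K) y Φ⟫_ℂ =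
          (r j : ℂ) ^ 2 * ⟪b i, y (b j)⟫_ℂ := by
        rw [inner_tensorVec_tensorOp, ContinuousLinearMap.adjoint_id, ContinuousLinearMap.id_apply,
          ← inner_antiOp, (h j).2, inner_smul_left, hT.symm, hT.apply_basis h,
          inner_smul_right, ContinuousLinearMap.adjoint_inner_left]
        simp only [Complex.conj_ofReal]
        linear_combination (r j : ℂ) ^ 2 * ⟪b i, y (b j)⟫_ℂ * hs
      rw [h1, h2]
      push_cast
      field_simp)
  rw [(h i).2, (h j).2, ← tensorRight_apply, ← tensorRight_apply, map_smul (tensorRight K (b i)),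
    map_smul (tensorRight K (b j)), map_smulₛₗ J, smul_smul, Complex.conj_ofReal, tensorRight_apply, tensorRight_apply] at key
  have h3 : ((r i / r j : ℝ) : ℂ) * r j = r i := by
    push_cast
    field_simp
  rw [h3] at key
  exact smul_right_injective _ hi key

theorem IsModularConjugation.apply_tensorVec
    (hJ : IsModularConjugation (rightFactor K K) Φ J) (hT : IsSignedAntiOp (antiOp Φ) σ)
    (h : IsSchmidt (antiOp Φ) b b' r) {θ : K ≃ₗᵢ⋆[ℂ] K} (hθ : ∀ k, θ (b k) = b' k) (e f : K) :
    J (tensorVec (θ f) e) = tensorVec (θ e) f := by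
  have h1 : ∀ j e, J (tensorVec (b' j) e) = tensorVec (θ e) (b j) := fun j e => by
    have : (J : HilbertTensor K K →L⋆[ℂ] HilbertTensor K K).comp (tensorLeft K (b' j)) =
        (tensorRight K (b j)).comp (θ : K →L⋆[ℂ] K) := b.ext_clm fun i => by
      change J (tensorVec (b' j) (b i)) = tensorVec (θ (b i)) (b j)
      rw [hθ, hJ.apply_tensorVec_basis hT h]
    exact congrArg (fun f => f e) this
  have h2 : ((J : HilbertTensor K K →L⋆[ℂ] HilbertTensor K K).comp (tensorRight K e)).comp
      (θ : K →L⋆[ℂ] K) = tensorLeft K (θ e) := b.ext_clm fun j => by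
    change J (tensorVec (θ (b j)) e) = tensorVec (θ e) (b j)
    rw [hθ, h1]
  exact congrArg (fun g => g f) h2

end ModularFlip

/-! ### Anti-unitaries that implement the modular conjugation -/

namespace SpinChain

variable {K : Type*} [NormedAddCommGroup K] [InnerProductSpace ℂ K]
  {J : HilbertTensor K K ≃ₗᵢ⋆[ℂ] HilbertTensor K K} {θ θ' : K ≃ₗᵢ⋆[ℂ] K}

theorem antiConj_apply_apply (θ : K ≃ₗᵢ⋆[ℂ] K) (x : K →L[ℂ] K) (ξ : K) :
    antiConj θ x (θ ξ) = θ (x ξ) := by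
  change θ (x (θ.symm (θ ξ))) = _
  rw [θ.symm_apply_apply]

theorem implements_of_apply_tensorVec
    (h : ∀ e f, J (tensorVec (θ f) e) = tensorVec (θ e) f) : Implements J θ := fun x => by
  refine clm_ext_tensorVec fun ξ f => ?_
  obtain ⟨e, rfl⟩ := θ.surjective ξ
  have h1 := antiConj_apply_apply J (tensorOp (.id ℂ K) x) (tensorVec (θ f) e)
  rw [h, tensorOp_tensorVec, ContinuousLinearMap.id_apply, h] at h1
  rw [tensorOp_tensorVec, antiConj_apply_apply]
  exact h1

theorem Implements.antiConj_eq (h : Implements J θ) (h' : Implements J θ') (x : K →L[ℂ] K) :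
    antiConj θ x = antiConj θ' x := by
  have h1 := (h x).symm.trans (h' x)
  ext ξ
  by_cases h0 : ξ = 0
  · simp [h0]
  have h2 := congrArg (fun f => f (tensorVec ξ ξ)) h1
  simp only [tensorOp_tensorVec, ContinuousLinearMap.id_apply] at h2
  rw [← tensorRight_apply, ← tensorRight_apply, ← sub_eq_zero, ← map_sub, tensorRight_apply, ← norm_eq_zero, norm_tensorVec, mul_eq_zero,
    norm_eq_zero, norm_eq_zero, or_iff_left h0] at h2
  exact sub_eq_zero.mp h2

theorem Implements.apply_apply_eq (h : Implements J θ) (h' : Implements J θ') (ξ : K) :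
    θ' (θ' ξ) = θ (θ ξ) := by
  rcases subsingleton_or_nontrivial K with hK | hK
  · exact Subsingleton.elim _ _
  obtain ⟨η, hη⟩ := exists_ne (0 : K)
  have hn : ⟪η, η⟫_ℂ ≠ 0 := inner_self_ne_zero.mpr hη
  obtain ⟨c, hc⟩ : ∃ c : ℂ, ∀ ξ, θ' ξ = c • θ ξ := by
    -- The constant is found by evaluating both conjugations of `|ξ⟩⟨η|` at `θ' η`; the bar appears
    -- because `θ` is antilinear.
    refine ⟨starRingEnd ℂ (⟪η, θ.symm (θ' η)⟫_ℂ / ⟪η, η⟫_ℂ), fun ξ => ?_⟩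
    have h1 := congrArg (fun f => f (θ' η))
      (h.antiConj_eq h' (InnerProductSpace.rankOne ℂ ξ η))
    simp only [antiConj_apply_apply, InnerProductSpace.rankOne_apply, map_smulₛₗ] at h1
    have h2 : antiConj θ (InnerProductSpace.rankOne ℂ ξ η) (θ' η) =
      θ (⟪η, θ.symm (θ' η)⟫_ℂ • ξ) := rfl
    rw [h2, map_smulₛₗ] at h1
    rw [map_div₀, div_eq_inv_mul, mul_smul, h1, smul_smul, inv_mul_cancel₀, one_smul]
    exact (map_ne_zero _).mpr hn
  have hc1 : ‖c‖ = 1 := by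
    have h1 := congrArg norm (hc η)
    rw [norm_smul, θ.norm_map, θ'.norm_map] at h1
    exact (mul_eq_right₀ (norm_ne_zero_iff.mpr hη)).mp h1.symm
  rw [hc, hc, map_smulₛₗ, smul_smul, Complex.mul_conj, Complex.normSq_eq_norm_sq, hc1]
  simp

end SpinChain

/-! ### Support projection and restriction to the corner -/

namespace SpinChain

section Support

variable {H : Type*} [NormedAddCommGroup H] [InnerProductSpace ℂ H] [CompleteSpace H]
  {Ω : HilbertTensor H H} {s : H →L[ℂ] H} {σ : ℤ}

theorem inner_proj_left (hs : IsStarProjection s) (x y : H) : ⟪s x, y⟫_ℂ = ⟪x, s y⟫_ℂ := by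
  rw [← ContinuousLinearMap.adjoint_inner_right, ← ContinuousLinearMap.star_eq_adjoint,
    hs.isSelfAdjoint.star_eq]

theorem proj_apply_apply (hs : IsStarProjection s) (x : H) : s (s x) = s x :=
  congrArg (fun f => f x) hs.isIdempotentElem.eq

theorem proj_apply_of_mem (hs : IsStarProjection s) {x : H} (hx : x ∈ corner s) : s x = x := by
  obtain ⟨y, rfl⟩ := hx
  exact proj_apply_apply hs y

theorem isStarProjection_tensorOp_id (hs : IsStarProjection s) :
    IsStarProjection (tensorOp (.id ℂ H) s) := by
  constructor
  · change tensorOp (.id ℂ H) s ∘L tensorOp (.id ℂ H) s = _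
    refine clm_ext_tensorVec fun ξ η => ?_
    simp only [ContinuousLinearMap.comp_apply, tensorOp_tensorVec, proj_apply_apply hs,
      ContinuousLinearMap.id_apply]
  · rw [IsSelfAdjoint, ContinuousLinearMap.star_eq_adjoint, adjoint_tensorOp,
      ContinuousLinearMap.adjoint_id, ← ContinuousLinearMap.star_eq_adjoint,
      hs.isSelfAdjoint.star_eq]

theorem antiOp_proj (hs : IsStarProjection s) (hΩ : tensorOp (.id ℂ H) s Ω = Ω) (η : H) :
    antiOp Ω (s η) = antiOp Ω η := by
  refine ext_inner_left ℂ fun ξ => ?_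
  rw [inner_antiOp, inner_antiOp]
  conv_rhs => rw [← hΩ]
  rw [inner_tensorVec_tensorOp, ContinuousLinearMap.adjoint_id,
    ← ContinuousLinearMap.star_eq_adjoint, hs.isSelfAdjoint.star_eq]
  rfl

/-- The vector is supported in `s` on the right, meaning `T s = T`; the symmetry of `T` turns this
into `s T = T`. This is where left and right supports are matched. -/
theorem antiOp_mem_corner (hs : IsStarProjection s) (hΩ : tensorOp (.id ℂ H) s Ω = Ω)
    (hsymm : ∀ ξ η, ⟪ξ, antiOp Ω η⟫_ℂ = σ * ⟪η, antiOp Ω ξ⟫_ℂ) (η : H) :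
    antiOp Ω η ∈ corner s := by
  refine ⟨antiOp Ω η, ext_inner_left ℂ fun ξ => ?_⟩
  change ⟪ξ, s (antiOp Ω η)⟫_ℂ = _
  rw [← inner_proj_left hs, hsymm, antiOp_proj hs hΩ, ← hsymm]

/-- The support projection of `Ω` maps into every closed subspace on whose complement the
antilinear operator of `Ω` vanishes. -/
theorem support_apply_mem
    (hsupp : IsSupportProjection (rightFactor H H) Ω (tensorOp (.id ℂ H) s))
    (V : Submodule ℂ H) [V.HasOrthogonalProjection] (hV : ∀ η ∈ Vᗮ, antiOp Ω η = 0) (ξ : H) :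
    s ξ ∈ V := by
  have hq : IsStarProjection V.starProjection := isStarProjection_starProjection
  -- `T` ignores `Vᗮ`, so the projection `1 ⊗ P_V` fixes `Ω`, and minimality of the support gives
  -- `P_V s = s`.
  have hfix : tensorOp (.id ℂ H) V.starProjection Ω = Ω := by
    refine ext_inner_tensorVec fun ξ η => ?_
    have h1 : antiOp Ω (V.starProjection η) = antiOp Ω η := by
      rw [← sub_eq_zero, ← map_sub, ← neg_sub, map_neg,
        hV _ (V.sub_starProjection_mem_orthogonal η), neg_zero]
    rw [inner_tensorVec_tensorOp, ContinuousLinearMap.adjoint_id,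
      ← ContinuousLinearMap.star_eq_adjoint, hq.isSelfAdjoint.star_eq,
      ContinuousLinearMap.id_apply, ← inner_antiOp, ← inner_antiOp, h1]
  have h2 := hsupp.le _ ⟨V.starProjection, rfl⟩ (isStarProjection_tensorOp_id hq) hfix
  by_cases h0 : s ξ = 0
  · rw [h0]
    exact V.zero_mem
  have h3 : tensorOp (.id ℂ H) V.starProjection (tensorOp (.id ℂ H) s (tensorVec (s ξ) ξ)) =
      tensorOp (.id ℂ H) s (tensorVec (s ξ) ξ) := congrArg (fun f => f (tensorVec (s ξ) ξ)) h2
  rw [tensorOp_tensorVec, tensorOp_tensorVec, ContinuousLinearMap.id_apply,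
    ContinuousLinearMap.id_apply, ← tensorLeft_apply, ← tensorLeft_apply, ← sub_eq_zero,
    ← map_sub, tensorLeft_apply, ← norm_eq_zero, norm_tensorVec, mul_eq_zero, norm_eq_zero,
    norm_eq_zero, or_iff_right h0] at h3
  exact Submodule.starProjection_eq_self_iff.mp (sub_eq_zero.mp h3)

theorem completeSpace_corner (hs : IsStarProjection s) : CompleteSpace (corner s) := by
  have h : (corner s : Set H) = {x | s x = x} :=
    Set.ext fun x => ⟨fun hx => proj_apply_of_mem hs hx, fun hx => ⟨x, hx⟩⟩
  have hcl : IsClosed (corner s : Set H) := by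
    rw [h]
    exact isClosed_eq s.continuous continuous_id
  exact hcl.completeSpace_coe

theorem adjoint_rangeRestrict [CompleteSpace (corner s)] (hs : IsStarProjection s)
    (ξ : corner s) : ContinuousLinearMap.adjoint s.rangeRestrict ξ = (ξ : H) := by
  refine ext_inner_right ℂ fun y => ?_
  rw [ContinuousLinearMap.adjoint_inner_left]
  change ⟪(ξ : H), s y⟫_ℂ = _
  rw [← inner_proj_left hs, proj_apply_of_mem hs ξ.2]

theorem coe_antiOp_cornerVec [CompleteSpace (corner s)] (hs : IsStarProjection s)
    (hΩ : tensorOp (.id ℂ H) s Ω = Ω)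
    (hsymm : ∀ ξ η, ⟪ξ, antiOp Ω η⟫_ℂ = σ * ⟪η, antiOp Ω ξ⟫_ℂ) (η : corner s) :
    (antiOp (cornerVec s Ω) η : H) = antiOp Ω (η : H) := by
  suffices antiOp (cornerVec s Ω) η =
      ⟨antiOp Ω (η : H), antiOp_mem_corner hs hΩ hsymm η⟩ from congrArg Subtype.val this
  refine ext_inner_left ℂ fun ξ => ?_
  rw [inner_antiOp, cornerVec, inner_tensorVec_tensorOp, adjoint_rangeRestrict hs,
    adjoint_rangeRestrict hs, ← inner_antiOp]
  rfl

theorem isSignedAntiOp_cornerVec [CompleteSpace (corner s)] (hs : IsStarProjection s)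
    (hsupp : IsSupportProjection (rightFactor H H) Ω (tensorOp (.id ℂ H) s))
    (hσ : σ = 1 ∨ σ = -1) (hsymm : ∀ ξ η, ⟪ξ, antiOp Ω η⟫_ℂ = σ * ⟪η, antiOp Ω ξ⟫_ℂ) :
    IsSignedAntiOp (antiOp (cornerVec s Ω)) σ where
  sign := hσ
  symm ξ η := by
    rw [Submodule.coe_inner, Submodule.coe_inner, coe_antiOp_cornerVec hs hsupp.apply_eq hsymm,
      coe_antiOp_cornerVec hs hsupp.apply_eq hsymm, hsymm]
  inj η h0 := by
    have h1 : antiOp Ω (η : H) = 0 := by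
      rw [← coe_antiOp_cornerVec hs hsupp.apply_eq hsymm, h0]
      rfl
    -- If `T η = 0`, the support lies in the complement of `η`; but `s η = η`, so `η` is orthogonal
    -- to itself.
    have h2 := support_apply_mem hsupp (Submodule.span ℂ {(η : H)})ᗮ (fun y hy => by
      rw [Submodule.orthogonal_orthogonal] at hy
      obtain ⟨c, rfl⟩ := Submodule.mem_span_singleton.mp hy
      rw [map_smulₛₗ, h1, smul_zero]) (η : H)
    rw [proj_apply_of_mem hs η.2, Submodule.mem_orthogonal_singleton_iff_inner_right,
      inner_self_eq_zero] at h2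
    exact Subtype.ext h2

end Support

/-! ### Schmidt decompositions as singular value decompositions -/

section Schmidt

variable {H : Type*} [NormedAddCommGroup H] [InnerProductSpace ℂ H] [CompleteSpace H]
  {Ω : HilbertTensor H H} {σ : ℤ} {ι : Type*} {r : ι → ℂ} {ξ ζ : ι → H}

theorem hasSum_inner_antiOp
    (h : HasSum (fun k => r k • tensorVec (ξ k) (ζ k)) Ω) (x y : H) :
    HasSum (fun k => r k * (⟪x, ξ k⟫_ℂ * ⟪y, ζ k⟫_ℂ)) ⟪x, antiOp Ω y⟫_ℂ := by
  have h1 := h.mapL (innerSL ℂ (tensorVec x y))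
  rw [inner_antiOp]
  convert! h1 using 2 with k
  rw [innerSL_apply_apply, inner_smul_right, inner_tensorVec]

theorem antiOp_eq_of_hasSum (hζ : Orthonormal ℂ ζ)
    (h : HasSum (fun k => r k • tensorVec (ξ k) (ζ k)) Ω) (k : ι) :
    antiOp Ω (ζ k) = r k • ξ k := by
  refine ext_inner_left ℂ fun x => ?_
  refine (hasSum_inner_antiOp h x (ζ k)).unique ?_
  have h2 := hasSum_single (f := fun j => r j * (⟪x, ξ j⟫_ℂ * ⟪ζ k, ζ j⟫_ℂ)) k
    fun j hj => by rw [hζ.2 hj.symm, mul_zero, mul_zero]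
  rw [inner_self_eq_norm_sq_to_K, hζ.1] at h2
  rw [inner_smul_right]
  simpa using h2

theorem antiOp_eq_zero_of_hasSum
    (h : HasSum (fun k => r k • tensorVec (ξ k) (ζ k)) Ω) {y : H}
    (hy : ∀ k, ⟪y, ζ k⟫_ℂ = 0) : antiOp Ω y = 0 := by
  refine ext_inner_left ℂ fun x => (hasSum_inner_antiOp h x y).unique ?_
  simp [hy]

/-- Exchanging the two families of a Schmidt decomposition of a vector with `F Ω = σ Ω`. -/
theorem hasSum_flip (hσ : (σ : ℂ) * σ = 1)
    (hsymm : ∀ x y, ⟪x, antiOp Ω y⟫_ℂ = σ * ⟪y, antiOp Ω x⟫_ℂ)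
    (h : HasSum (fun k => r k • tensorVec (ξ k) (ζ k)) Ω) :
    HasSum (fun k => (σ * r k) • tensorVec (ζ k) (ξ k)) Ω := by
  have h1 := (h.mapL (tensorFlip H H)).const_smul (σ : ℂ)
  have h2 : (σ : ℂ) • tensorFlip H H Ω = Ω := by
    refine ext_inner_tensorVec fun x y => ?_
    rw [inner_smul_right, ← ContinuousLinearMap.adjoint_inner_left, adjoint_tensorFlip,
      tensorFlip_tensorVec, ← inner_antiOp, hsymm, ← mul_assoc, hσ, one_mul, inner_antiOp]
  rw [h2] at h1
  simpa only [map_smul, tensorFlip_tensorVec, smul_smul] using h1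

end Schmidt

/-! ### The reflection symmetry of `T` and the main theorem -/

section Main

variable {d : ℕ} {H : Type*} [NormedAddCommGroup H] [InnerProductSpace ℂ H] [CompleteSpace H]
  {ω : Chain d →ₗ[ℂ] ℂ} {π : ChainR d →⋆ₐ[ℂ] (H →L[ℂ] H)}
  {Ω : HilbertTensor H H} {Γ : HilbertTensor H H ≃ₗᵢ[ℂ] HilbertTensor H H}

theorem IsReflectionSplitRep.inner_antiOp_symm (h : IsReflectionSplitRep ω π Ω Γ) {σ : ℤ}
    (hΓ : ∀ ξ η : H, Γ (tensorVec ξ η) = σ • tensorVec η ξ) (ξ η : H) :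
    ⟪ξ, antiOp Ω η⟫_ℂ = σ * ⟪η, antiOp Ω ξ⟫_ℂ := by
  rw [inner_antiOp, inner_antiOp, ← Γ.inner_map_map, h.apply_vector, hΓ,
    ← Int.cast_smul_eq_zsmul ℂ σ, inner_smul_left, map_intCast]

end Main

theorem schmidt_sign {K : Type*} [NormedAddCommGroup K] [InnerProductSpace ℂ K] {ι : Type*}
    {T : K →L⋆[ℂ] K} {σ : ℤ} {b b' : HilbertBasis ι ℂ K} {r : ι → ℝ} (hT : IsSignedAntiOp T σ)
    (h : IsSchmidt T b b' r) : ∃ (w : K ≃ₗᵢ[ℂ] K) (c : K ≃ₗᵢ⋆[ℂ] K),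
      (∀ k, w (b k) = b' k) ∧ (∀ k, c (b k) = b k) ∧
        ∀ η, w η = σ • c.symm (w.symm (c η)) := by
  classical
  let w : K ≃ₗᵢ[ℂ] K := b.repr.trans b'.repr.symm
  let c : K ≃ₗᵢ⋆[ℂ] K := antiunitaryOfBases b b
  have hw : ∀ k, w (b k) = b' k := fun k => by
    change b'.repr.symm (b.repr (b k)) = b' k
    rw [b.repr_self, b'.repr_symm_single]
  have hc : ∀ k, c (b k) = b k := antiunitaryOfBases_apply b b
  refine ⟨w, c, hw, hc, fun η => ?_⟩
  -- `w c` is the anti-unitary `b_k ↦ b'_k`, so its square is `σ`; together with `c² = 1` this is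
  -- the claimed identity, read at `c⁻¹ w⁻¹ c η`.
  have hsq : ∀ y, w (c (w (c y))) = σ • y := hT.antiunitary_sq h (θ := c.trans w) fun k => by
    change w (c (b k)) = b' k
    rw [hc, hw]
  have hcc : ∀ y, c (c y) = y := fun y => by
    have : (c : K →L⋆[ℂ] K).comp (c : K →L⋆[ℂ] K) = .id ℂ K := b.ext_clm fun k => by
      change c (c (b k)) = b k
      rw [hc, hc]
    exact congrArg (fun f => f y) this
  have h1 := hsq (c.symm (w.symm (c η)))
  rwa [c.apply_symm_apply, w.apply_symm_apply, hcc] at h1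

end SpinChain

end

theorem theorem4p4 {d : ℕ} (hd : 2 ≤ d)
    (ω : SpinChain.Chain d →ₗ[ℂ] ℂ) (hpure : IsPureState ω)
    (hrefl : ∀ a, ω (SpinChain.reflection d a) = ω a) (hsplit : SpinChain.HasSplitProperty ω)
    {H : Type u} [NormedAddCommGroup H] [InnerProductSpace ℂ H] [CompleteSpace H]
    (π : SpinChain.ChainR d →⋆ₐ[ℂ] (H →L[ℂ] H)) (Ω : HilbertTensor H H)
    (Γ : HilbertTensor H H ≃ₗᵢ[ℂ] HilbertTensor H H)
    (hrep : SpinChain.IsReflectionSplitRep ω π Ω Γ)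
    (s : H →L[ℂ] H) (hs : IsStarProjection s)
    (hsupp : IsSupportProjection (rightFactor H H) Ω (tensorOp (ContinuousLinearMap.id ℂ H) s))
    (J : HilbertTensor (SpinChain.corner s) (SpinChain.corner s) ≃ₗᵢ⋆[ℂ]
      HilbertTensor (SpinChain.corner s) (SpinChain.corner s))
    (hJ : IsModularConjugation (rightFactor (SpinChain.corner s) (SpinChain.corner s))
      (SpinChain.cornerVec s Ω) J) :
    -- the index is a sign, and it is the sign of the flip in the given representation
    (SpinChain.reflectionIndex.{u} ω = 1 ∨ SpinChain.reflectionIndex.{u} ω = -1) ∧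
    (∀ ξ η : H, Γ (tensorVec ξ η) = SpinChain.reflectionIndex.{u} ω • tensorVec η ξ) ∧
    -- the sign `κ` of the anti-unitaries that implement `J` equals the index
    (∃ θ : SpinChain.corner s ≃ₗᵢ⋆[ℂ] SpinChain.corner s, SpinChain.Implements J θ) ∧
    (∃ κ : ℤ, (κ = 1 ∨ κ = -1) ∧
      (∀ θ : SpinChain.corner s ≃ₗᵢ⋆[ℂ] SpinChain.corner s, SpinChain.Implements J θ →
        ∀ ξ, θ (θ ξ) = κ • ξ) ∧
      κ = SpinChain.reflectionIndex.{u} ω) ∧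
    -- the index from a Schmidt decomposition
    (∀ (ι : Type v) (lam : ι → ℝ) (ξ ζ : ι → H), (∀ k, 0 < lam k) →
      Orthonormal ℂ ξ → Orthonormal ℂ ζ →
      HasSum (fun k => (Real.sqrt (lam k) : ℂ) • tensorVec (ξ k) (ζ k)) Ω →
      ∃ (bξ bζ : HilbertBasis ι ℂ (SpinChain.corner s))
        (w : SpinChain.corner s ≃ₗᵢ[ℂ] SpinChain.corner s)
        (c : SpinChain.corner s ≃ₗᵢ⋆[ℂ] SpinChain.corner s),
        (∀ k, (bξ k : H) = ξ k) ∧ (∀ k, (bζ k : H) = ζ k) ∧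
        (∀ k, w (bζ k) = bξ k) ∧ (∀ k, c (bζ k) = bζ k) ∧
        ∀ η, w η = SpinChain.reflectionIndex.{u} ω • c.symm (w.symm (c η))) := by
  obtain ⟨hsign, hindex⟩ := hrep.isReflectionIndex
  set σ := SpinChain.reflectionIndex.{u} ω
  have hΓ : ∀ ξ η : H, Γ (tensorVec ξ η) = σ • tensorVec η ξ := hindex H π Ω Γ hrep
  have hsymm := hrep.inner_antiOp_symm hΓ
  have hK := SpinChain.completeSpace_corner hs
  have hcoe := SpinChain.coe_antiOp_cornerVec hs hsupp.apply_eq hsymm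
  have hmem := SpinChain.antiOp_mem_corner hs hsupp.apply_eq hsymm
  have hT := SpinChain.isSignedAntiOp_cornerVec hs hsupp hsign hsymm
  obtain ⟨θ, hθJ, hθsq⟩ : ∃ θ : SpinChain.corner s ≃ₗᵢ⋆[ℂ] SpinChain.corner s,
      SpinChain.Implements J θ ∧ ∀ ξ, θ (θ ξ) = σ • ξ := by
    obtain ⟨ι, b, b', r, hb⟩ := hT.exists_isSchmidt (isCompactOperator_antiOp _)
    have hθ := antiunitaryOfBases_apply b b'
    exact ⟨antiunitaryOfBases b b',
      SpinChain.implements_of_apply_tensorVec (hJ.apply_tensorVec hT hb hθ),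
      hT.antiunitary_sq hb hθ⟩
  refine ⟨hsign, hΓ, ⟨θ, hθJ⟩, ⟨σ, hsign, fun θ' hθ' ξ => ?_, rfl⟩, ?_⟩
  · rw [hθJ.apply_apply_eq hθ', hθsq]
  intro ι lam ξ ζ hlam hξ hζ hsum
  have hr : ∀ k, 0 < Real.sqrt (lam k) := fun k => Real.sqrt_pos.mpr (hlam k)
  have hr0 : ∀ k, (Real.sqrt (lam k) : ℂ) ≠ 0 := fun k => by exact_mod_cast (hr k).ne'
  have hTζ := SpinChain.antiOp_eq_of_hasSum hζ hsum
  -- The flipped expansion gives `T ξ_k = σ √λ_k ζ_k`, which places `ζ_k` in the range of `T`, hence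
  -- in the corner, and later yields completeness of the family `ξ`.
  have hsum' := SpinChain.hasSum_flip hT.sign_mul_self hsymm hsum
  have hTξ := SpinChain.antiOp_eq_of_hasSum hξ hsum'
  have hσ0 : (σ : ℂ) ≠ 0 := left_ne_zero_of_mul_eq_one hT.sign_mul_self
  have hξmem : ∀ k, ξ k ∈ SpinChain.corner s := fun k => by
    have h1 := hmem (ζ k)
    rwa [hTζ, Submodule.smul_mem_iff _ (hr0 k)] at h1
  have hζmem : ∀ k, ζ k ∈ SpinChain.corner s := fun k => by
    have h1 := hmem (ξ k)
    rwa [hTξ, Submodule.smul_mem_iff _ (mul_ne_zero hσ0 (hr0 k))] at h1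
  have hbasis : ∀ x : ι → H, ∀ hx : ∀ k, x k ∈ SpinChain.corner s, Orthonormal ℂ x →
      (∀ y, (∀ k, ⟪y, x k⟫_ℂ = 0) → antiOp Ω y = 0) →
      ∃ b : HilbertBasis ι ℂ (SpinChain.corner s), ∀ k, (b k : H) = x k := by
    intro x hx hon h0
    have hon' : Orthonormal ℂ fun k => (⟨x k, hx k⟩ : SpinChain.corner s) :=
      ⟨fun k => hon.1 k, fun i j hij => hon.2 hij⟩
    refine ⟨HilbertBasis.mkOfOrthogonalEqBot hon' (eq_bot_iff.mpr fun y hy => ?_), fun k => ?_⟩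
    -- A corner vector orthogonal to the family is killed by `T`, which is injective on the corner.
    · refine hT.inj y (Subtype.ext ((hcoe y).trans (h0 y fun k => ?_)))
      exact inner_eq_zero_symm.mp
        ((Submodule.mem_orthogonal _ _).mp hy _ (Submodule.subset_span ⟨k, rfl⟩))
    · rw [HilbertBasis.coe_mkOfOrthogonalEqBot]
  obtain ⟨bξ, hbξ⟩ := hbasis ξ hξmem hξ fun y => SpinChain.antiOp_eq_zero_of_hasSum hsum'
  obtain ⟨bζ, hbζ⟩ := hbasis ζ hζmem hζ fun y => SpinChain.antiOp_eq_zero_of_hasSum hsum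
  have hb : IsSchmidt (antiOp (SpinChain.cornerVec s Ω)) bζ bξ fun k => Real.sqrt (lam k) :=
    fun k => ⟨hr k, Subtype.ext <| by
      rw [hcoe, hbζ, hTζ, ← hbξ]
      rfl⟩
  obtain ⟨w, c, hw, hc, hwc⟩ := SpinChain.schmidt_sign hT hb
  exact ⟨bξ, bζ, w, c, hbξ, hbζ, hw, hc, hwc⟩
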